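/- Let $d,n\ge 1$, let $\omega$ be a symplectic form on $\mathbb R^{2d}$ (smooth, closed, nondegenerate), let $D\subset\mathbb R^{2d}$ be open, and let $F_\epsilon:D\to\mathbb R^{2d}$, $|\epsilon|<\epsilon_0$, be a near-identity family ($F_0=\mathrm{id}$) of maps preserving $\omega$, of class $C^{2n+1}$ jointly in $(x,\epsilon)$. For negative $k$ the iterates $x_k=F_\epsilon^k(x)$ are taken with the local inverse of $F_\epsilon$: $F_\epsilon^{-1}(x)$ is the preimage of $x$ in $D$ closest to $x$ (the only preimage, if $F_\epsilon$ is injective). For $\epsilon\neq0$ let $p_n(t,x,\epsilon)$ be the polynomial in $t$ of degree at most $2n$ with $p_n(\epsilon k,x,\epsilon)=x_k$ for $|k|\le n$, let $X_n(x,\epsilon)=\partial_tp_n(0,x,\epsilon)$ be the interpolating vector field and let $\nu_n=\omega(X_n,\cdot)$. Fix $x_b\in D$, and for every $x\in D$ a piecewise $C^1$ path $\gamma(x_b,x)$ in $D$ from $x_b$ to $x$, of length at most $C_\gamma|x-x_b|$ with $C_\gamma$ independent of $x$, such that for every compact $K\subset D$ the paths $\gamma(x_b,x)$, $x\in K$,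 lie in a common compact subset of $D$. Define $$h_n(x,\epsilon)=\int_{\gamma(x_b,x)}\nu_n .$$ Assume that $F_\epsilon$ has a Hamiltonian suspension of the following form: every compact $K\subset D$ has an open neighbourhood $U\subset D$ such that for all sufficiently small $\epsilon\ne0$ there is a vector field $Y(\tau,x,\epsilon)$, $x\in U$, 1-periodic in $\tau$, such that every solution in $U$ of $\partial_\tau\xi=\epsilon Y(\tau,\xi,\epsilon)$, $0\le\tau\le1$, satisfies $\xi(1)=F_\epsilon(\xi(0))$, and $\omega(Y,\cdot)=d_xh$ with $$h(\tau,x,\epsilon)=h^a_n(x,\epsilon)+\epsilon^{2n}h^b_n(\tau,x,\epsilon),$$ where $h^b_n$ is 1-periodic in $\tau$ and the $C^{2n+1}$ norms of $h^a_n(\cdot,\epsilon)$ on $U$ and of $h^b_n(\cdot,\cdot,\epsilon)$ on $\mathbb R\times U$ are bounded uniformly in $\epsilon$. (For example, this holds if there is such a suspension with $U=D$.) Then $h_n$ is an adiabatic invariant of $F_\epsilon$. Namely, for every compact $D_0\subset D$ there are constants $C$ and $\epsilon_1\in(0,\epsilon_0]$ such that for $0<|\epsilon|<\epsilon_1$ the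 following hold. 1. For every $x\in D_0$, $F_\epsilon(x)\in D$, the integrals defining $h_n(x,\epsilon)$ and $h_n(F_\epsilon(x),\epsilon)$ are well defined, and $$|h_n(F_\epsilon(x),\epsilon)-h_n(x,\epsilon)|\le C\,\epsilon^{2n}.$$ 2. $h_n$ is approximately preserved for about $\epsilon^{-2n}$ iterates: for every real $T$ and every integer $N\ge 0$ with $N\le T\epsilon^{-2n}$, if $x,F_\epsilon(x),\dots,F_\epsilon^N(x)$ all lie in $D_0$, then $$|h_n(F_\epsilon^N(x),\epsilon)-h_n(x,\epsilon)|\le C\,(1+T)\,|\epsilon| .$$ -/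

import Mathlib

open Set Filter Topology
open scoped unitInterval

/-- Phase space `ℝ^{2d}` with its Euclidean norm. -/
abbrev PhaseSpace (d : ℕ) : Type := EuclideanSpace ℝ (Fin (2 * d))

/-- The covector `ω(u, ·)` obtained from an alternating bilinear form `ω`. -/
noncomputable def contractForm {d : ℕ} (ω : PhaseSpace d [⋀^Fin 2]→L[ℝ] ℝ)
    (u : PhaseSpace d) : PhaseSpace d →L[ℝ] ℝ :=
  (ContinuousAlternatingMap.ofSubsingleton ℝ (PhaseSpace d) ℝ (0 : Fin 1)).symm
    (ω.curryLeft u)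

theorem contractForm_apply {d : ℕ} (ω : PhaseSpace d [⋀^Fin 2]→L[ℝ] ℝ)
    (u v : PhaseSpace d) : contractForm ω u v = ω ![u, v] := by
  have h : (fun _ : Fin 1 => v) = ![v] := by
    funext i
    fin_cases i
    rfl
  change ω.curryLeft u (fun _ : Fin 1 => v) = ω ![u, v]
  rw [h]
  rfl

/-- A symplectic form on `ℝ^{2d}`: a smooth, closed, nondegenerate differential 2-form. -/
structure IsSymplecticForm {d : ℕ} (ω : PhaseSpace d → PhaseSpace d [⋀^Fin 2]→L[ℝ] ℝ) :
    Prop where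
  smooth : ContDiff ℝ (⊤ : ℕ∞) ω
  closed : ∀ x, extDeriv ω x = 0
  nondegenerate : ∀ x u, (∀ v, ω x ![u, v] = 0) → u = 0

/-- The map `f : D → ℝ^{2d}` preserves `ω`, i.e. `f^* ω = ω` on `D`. -/
def IsSymplecticMapOn {d : ℕ} (ω : PhaseSpace d → PhaseSpace d [⋀^Fin 2]→L[ℝ] ℝ)
    (f : PhaseSpace d → PhaseSpace d) (D : Set (PhaseSpace d)) : Prop :=
  ∀ x ∈ D, ∀ u v, ω (f x) ![fderiv ℝ f x u, fderiv ℝ f x v] = ω x ![u, v]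

/-- A family `F_ε : D → ℝ^{2d}`, `|ε| < ε₀`, of near-identity symplectic maps which is of class
`C^r` jointly in `(x, ε)`. -/
structure IsNearIdentitySymplecticFamily {d : ℕ}
    (ω : PhaseSpace d → PhaseSpace d [⋀^Fin 2]→L[ℝ] ℝ) (D : Set (PhaseSpace d)) (ε₀ : ℝ)
    (r : ℕ∞) (F : ℝ → PhaseSpace d → PhaseSpace d) : Prop where
  smooth : ContDiffOn ℝ r (fun p : PhaseSpace d × ℝ => F p.2 p.1) (D ×ˢ Ioo (-ε₀) ε₀)
  near_identity : ∀ x ∈ D, F 0 x = x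
  symplectic : ∀ ε, |ε| < ε₀ → IsSymplecticMapOn ω (F ε) D

/-- The value `f⁻¹(x)` of the local inverse of a near-identity map `f : D → ℝ^{2d}`: the preimage
of `x` in `D` that is closest to `x`. If `f` is injective on `D` it is the only preimage, see
`localInverse_apply`; in general a near-identity map is injective on compact sets only, and the
inverse branch that is close to the identity is the one meant by `f⁻¹`. -/
noncomputable def localInverse {d : ℕ} (D : Set (PhaseSpace d))
    (f : PhaseSpace d → PhaseSpace d) (x : PhaseSpace d) : PhaseSpace d :=
  Classical.epsilon fun y =>
    (y ∈ D ∧ f y = x) ∧ ∀ z ∈ D, f z = x → dist y x ≤ dist z x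

theorem localInverse_apply {d : ℕ} {D : Set (PhaseSpace d)}
    {f : PhaseSpace d → PhaseSpace d} (hf : InjOn f D) {y : PhaseSpace d} (hy : y ∈ D) :
    localInverse D f (f y) = y := by
  have h : ∃ w, (w ∈ D ∧ f w = f y) ∧ ∀ z ∈ D, f z = f y → dist w (f y) ≤ dist z (f y) :=
    ⟨y, ⟨hy, rfl⟩, fun z hz hzy => by rw [hf hz hy hzy]⟩
  have h' := Classical.epsilon_spec h
  exact hf h'.1.1 hy h'.1.2

/-- The iterate `x_k = f^k(x)` for an integer `k`. -/
noncomputable def iterateZ {d : ℕ} (D : Set (PhaseSpace d)) (f : PhaseSpace d → PhaseSpace d)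
    (k : ℤ) (x : PhaseSpace d) : PhaseSpace d :=
  if 0 ≤ k then f^[k.toNat] x else (localInverse D f)^[(-k).toNat] x

/-- The iterates `x_k`, `|k| ≤ n`, of `x` are defined and lie in `D`. -/
def HasIterates {d : ℕ} (D : Set (PhaseSpace d)) (f : PhaseSpace d → PhaseSpace d) (n : ℕ)
    (x : PhaseSpace d) : Prop :=
  (∀ k : ℤ, -(n : ℤ) ≤ k → k ≤ n → iterateZ D f k x ∈ D) ∧
    ∀ k : ℤ, -(n : ℤ) ≤ k → k < n → f (iterateZ D f k x) = iterateZ D f (k + 1) x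

/-- The `i`-th component of the interpolating polynomial `p_n(t)` of degree at most `2 n`, with
`p_n(ε k) = x_k` for `|k| ≤ n`. -/
noncomputable def interpolatingPolynomial {d : ℕ} (D : Set (PhaseSpace d)) (n : ℕ) (ε : ℝ)
    (f : PhaseSpace d → PhaseSpace d) (x : PhaseSpace d) (i : Fin (2 * d)) : Polynomial ℝ :=
  Lagrange.interpolate (Finset.Icc (-(n : ℤ)) n) (fun k : ℤ => ε * (k : ℝ))
    (fun k : ℤ => iterateZ D f k x i)

/-- The interpolating vector field `X_n(x, ε) = ∂_t p_n(0, x, ε)` of the map `f = F_ε`. -/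
noncomputable def interpolatingField {d : ℕ} (D : Set (PhaseSpace d)) (n : ℕ) (ε : ℝ)
    (f : PhaseSpace d → PhaseSpace d) (x : PhaseSpace d) : PhaseSpace d :=
  WithLp.toLp 2 fun i => (interpolatingPolynomial D n ε f x i).derivative.eval 0

/-- The 1-form `ν_n = ω(X_n, ·)`. -/
noncomputable def interpolatingForm {d : ℕ}
    (ω : PhaseSpace d → PhaseSpace d [⋀^Fin 2]→L[ℝ] ℝ) (D : Set (PhaseSpace d)) (n : ℕ) (ε : ℝ)
    (f : PhaseSpace d → PhaseSpace d) (x : PhaseSpace d) : PhaseSpace d →L[ℝ] ℝ :=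
  contractForm (ω x) (interpolatingField D n ε f x)

/-- A continuous path that is `C¹` (up to the end points) on each interval of a finite
partition of `[0, 1]`. -/
def IsPiecewiseSmooth {d : ℕ} {a b : PhaseSpace d} (γ : Path a b) : Prop :=
  ∃ (N : ℕ) (t : ℕ → ℝ), Monotone t ∧ t 0 = 0 ∧ t N = 1 ∧
    ∀ i < N, ContDiffOn ℝ 1 γ.extend (Icc (t i) (t (i + 1)))

/-- The length of a piecewise smooth path. -/
noncomputable def pathLength {d : ℕ} {a b : PhaseSpace d} (γ : Path a b) : ℝ :=
  ∫ t in (0 : ℝ)..1, ‖derivWithin γ.extend I t‖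

/-- A rule that joins the base point `xb` to every `x ∈ D` by a piecewise smooth path in `D` of
length at most `C |x - xb|`, and such that the paths that lead to a compact subset of `D` stay in
a compact subset of `D`. (The values of `γ` outside `D` play no role.) -/
structure IsPathRule {d : ℕ} (D : Set (PhaseSpace d)) (xb : PhaseSpace d)
    (γ : ∀ x : PhaseSpace d, Path xb x) (C : ℝ) : Prop where
  mem : ∀ x ∈ D, ∀ t, γ x t ∈ D
  piecewise : ∀ x ∈ D, IsPiecewiseSmooth (γ x)
  length_le : ∀ x ∈ D, pathLength (γ x) ≤ C * ‖x - xb‖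
  compact : ∀ K ⊆ D, IsCompact K → ∃ K' ⊆ D, IsCompact K' ∧ ∀ x ∈ K, ∀ t, γ x t ∈ K'

/-- The function `h_n(x, ε) = ∫_{γ(xb, x)} ν_n`. -/
noncomputable def adiabaticInvariant {d : ℕ}
    (ω : PhaseSpace d → PhaseSpace d [⋀^Fin 2]→L[ℝ] ℝ) (D : Set (PhaseSpace d))
    {xb : PhaseSpace d} (γ : ∀ x : PhaseSpace d, Path xb x)
    (F : ℝ → PhaseSpace d → PhaseSpace d) (n : ℕ) (x : PhaseSpace d) (ε : ℝ) : ℝ :=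
  curveIntegral (interpolatingForm ω D n ε (F ε)) (γ x)

/-- The integral that defines `h_n(x, ε)` makes sense: `x` lies in `D`, the field `X_n(·, ε)` is
defined at all points of the path `γ(xb, x)`, and `ν_n` is integrable along it. -/
def AdiabaticInvariantDefined {d : ℕ}
    (ω : PhaseSpace d → PhaseSpace d [⋀^Fin 2]→L[ℝ] ℝ) (D : Set (PhaseSpace d))
    {xb : PhaseSpace d} (γ : ∀ x : PhaseSpace d, Path xb x)
    (F : ℝ → PhaseSpace d → PhaseSpace d) (n : ℕ) (x : PhaseSpace d) (ε : ℝ) : Prop :=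
  x ∈ D ∧ (∀ t, HasIterates D (F ε) n (γ x t)) ∧
    CurveIntegrable (interpolatingForm ω D n ε (F ε)) (γ x)

/-- On the open set `U` the 1-periodic field `Y` is a suspension of `f = F_ε`: every solution of
`∂_τ ξ = ε Y(τ, ξ)`, `ξ(0) = x`, which stays in `U` for `0 ≤ τ ≤ 1` satisfies `ξ(1) = f(x)`. -/
def IsSuspensionOn {d : ℕ} (U : Set (PhaseSpace d)) (ε : ℝ)
    (f : PhaseSpace d → PhaseSpace d) (Y : ℝ → PhaseSpace d → PhaseSpace d) : Prop :=
  (∀ τ, ∀ x ∈ U, Y (τ + 1) x = Y τ x) ∧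
    ∀ ξ : ℝ → PhaseSpace d,
      (∀ τ ∈ Icc (0 : ℝ) 1, ξ τ ∈ U ∧ HasDerivWithinAt ξ (ε • Y τ (ξ τ)) (Icc 0 1) τ) →
        ξ 1 = f (ξ 0)

/-- On the open set `U` the field `Y` is the Hamiltonian vector field of `H`:
`ω(Y, ·) = dH`. -/
def IsHamiltonianFieldOn {d : ℕ} (ω : PhaseSpace d → PhaseSpace d [⋀^Fin 2]→L[ℝ] ℝ)
    (U : Set (PhaseSpace d)) (H : PhaseSpace d → ℝ) (Y : PhaseSpace d → PhaseSpace d) : Prop :=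
  ∀ x ∈ U, contractForm (ω x) (Y x) = fderiv ℝ H x

/-- The function `g` is of class `C^r` on the open set `U` and `M` bounds all its derivatives of
order at most `r` on `U`. -/
def HasCkNormLE {E : Type*} [NormedAddCommGroup E] [NormedSpace ℝ E] (r : ℕ) (U : Set E)
    (M : ℝ) (g : E → ℝ) : Prop :=
  ContDiffOn ℝ r g U ∧ ∀ j ≤ r, ∀ x ∈ U, ‖iteratedFDeriv ℝ j g x‖ ≤ M

/-- On the open set `U`, for `0 < |ε| < ε₁`, the maps `F_ε` have a suspension which is the
Hamiltonian vector field of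
`h(τ, x, ε) = ha(x, ε) + ε^{2n} hb(τ, x, ε)`, with `hb` 1-periodic in `τ`,
where the `C^{2n+1}` norms of `ha(·, ε)` and `hb(·, ·, ε)` are bounded uniformly in `ε`. -/
def HasHamiltonianSuspensionOn {d : ℕ} (ω : PhaseSpace d → PhaseSpace d [⋀^Fin 2]→L[ℝ] ℝ)
    (U : Set (PhaseSpace d)) (ε₁ : ℝ) (n : ℕ) (F : ℝ → PhaseSpace d → PhaseSpace d) : Prop :=
  ∃ (ha : ℝ → PhaseSpace d → ℝ) (hb : ℝ → ℝ × PhaseSpace d → ℝ)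
    (Y : ℝ → ℝ → PhaseSpace d → PhaseSpace d) (M : ℝ),
    ∀ ε, 0 < |ε| → |ε| < ε₁ →
      HasCkNormLE (2 * n + 1) U M (ha ε) ∧
      HasCkNormLE (2 * n + 1) (univ ×ˢ U) M (hb ε) ∧
      (∀ τ, ∀ x ∈ U, hb ε (τ + 1, x) = hb ε (τ, x)) ∧
      (∀ τ, IsHamiltonianFieldOn ω U (fun x => ha ε x + ε ^ (2 * n) * hb ε (τ, x)) (Y ε τ)) ∧
      IsSuspensionOn U ε (F ε) (Y ε)

/-- Every compact subset of `D` has an open neighbourhood in `D` on which `F_ε` has, for all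
small `ε ≠ 0`, a Hamiltonian suspension as in `HasHamiltonianSuspensionOn`. In particular this
holds if there is one on all of `D`. -/
def HasHamiltonianSuspension {d : ℕ} (ω : PhaseSpace d → PhaseSpace d [⋀^Fin 2]→L[ℝ] ℝ)
    (D : Set (PhaseSpace d)) (n : ℕ) (F : ℝ → PhaseSpace d → PhaseSpace d) : Prop :=
  ∀ K ⊆ D, IsCompact K → ∃ U, IsOpen U ∧ K ⊆ U ∧ U ⊆ D ∧
    ∃ ε₁ > 0, HasHamiltonianSuspensionOn ω U ε₁ n F

/-!
The suspension `ξ' = ε Y(τ, ξ)` interpolates the iterates: on a compact set and for small `ε`, the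
orbit of `x` has `ξ(k) = x_k` for `|k| ≤ n`. For positive `k` this is the periodicity of `Y`; for
negative `k` it also uses that orbits hardly move and are unique, so that the preimage on the orbit
is the closest one (`IsSuspensionOn.exists_orbit`).

Write `Y = Ya + ε^{2n} Yb` with `Ya` autonomous. The fields `Ya` and `Yb` are of class `C^{2n}` with
bounds that do not depend on `ε`, because they arise from the differentials of `h^a` and `h^b` by the
inverse of `u ↦ ω(u, ·)` (`HasHamiltonianSuspensionOn.exists_field`). An induction shows that
`ξ^{(j)} = O(ε^j)` for `j ≤ 2n + 1`: differentiating `Ya(ξ)` gains a power of `ε` each time, and the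
part with the fast time has the factor `ε^{2n+1}` from the start
(`exists_norm_iteratedFDeriv_solution_le`).

By Rolle's theorem the derivative at `0` of the polynomial of degree `2n` through the points `ξ(k)`
differs from `ξ'(0) = ε Y(0, x)` by a multiple of the supremum of `ξ^{(2n+1)}`, which is
`O(ε^{2n+1})` (`norm_deriv_sub_interpolatingField_le`). Hence `X_n = Y + O(ε^{2n})` and
`ν_n = dh^a + O(ε^{2n})`, so that `h_n(x) = h^a(x) - h^a(x_b) + O(ε^{2n})`, as the paths have bounded
length. Finally `h^a` is constant along its own Hamiltonian field, so that it changes along an orbit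
of `ε Y` by `O(ε^{2n+1})` in a unit of time (`HasHamiltonianSuspensionOn.exists_estimates`). Both
claims follow: over `N` iterates the drift of `h^a` is `N O(ε^{2n+1})`, while the error
`O(ε^{2n})` of replacing `h_n` by `h^a` enters only at the two ends.
-/

/-! ### Uniform bounds on derivatives -/

section CkBounds

variable {E G H J : Type*} [NormedAddCommGroup E] [NormedSpace ℝ E]
  [NormedAddCommGroup G] [NormedSpace ℝ G] [NormedAddCommGroup H] [NormedSpace ℝ H]
  [NormedAddCommGroup J] [NormedSpace ℝ J]

/-- `f` is of class `C^r` on `S` and `C` bounds its derivatives of order at most `r` there: this is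
`HasCkNormLE` for maps with values in any normed space. The derivatives are those in the whole
space, so `S` is meant to be open or to lie in an open set where `f` is smooth. -/
def CkBoundedOn (r : ℕ) (S : Set E) (C : ℝ) (f : E → G) : Prop :=
  ContDiffOn ℝ r f S ∧ ∀ j ≤ r, ∀ x ∈ S, ‖iteratedFDeriv ℝ j f x‖ ≤ C

theorem CkBoundedOn.mono {r : ℕ} {S S' : Set E} {C C' : ℝ} {f : E → G}
    (hf : CkBoundedOn r S C f) (hS : S' ⊆ S) (hC : C ≤ C') : CkBoundedOn r S' C' f :=
  ⟨hf.1.mono hS, fun j hj x hx => (hf.2 j hj x (hS hx)).trans hC⟩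

theorem CkBoundedOn.norm_le {r : ℕ} {S : Set E} {C : ℝ} {f : E → G}
    (hf : CkBoundedOn r S C f) {x : E} (hx : x ∈ S) : ‖f x‖ ≤ C := by
  simpa using hf.2 0 (Nat.zero_le _) x hx

theorem CkBoundedOn.nonneg {r : ℕ} {S : Set E} {C : ℝ} {f : E → G}
    (hf : CkBoundedOn r S C f) {x : E} (hx : x ∈ S) : 0 ≤ C :=
  (norm_nonneg _).trans (hf.norm_le hx)

theorem CkBoundedOn.bilinear {r : ℕ} {S : Set E} (hS : IsOpen S) {C₁ C₂ : ℝ} {f : E → G}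
    {g : E → H} (B : G →L[ℝ] H →L[ℝ] J) (hf : CkBoundedOn r S C₁ f) (hg : CkBoundedOn r S C₂ g) :
    CkBoundedOn r S (‖B‖ * (2 ^ r * (C₁ * C₂))) (fun x => B (f x) (g x)) := by
  refine ⟨(B.isBoundedBilinearMap.contDiff.comp_contDiffOn (hf.1.prodMk hg.1) :), ?_⟩
  intro j hj x hx
  have h1 := hf.nonneg hx
  have h2 := hg.nonneg hx
  rw [← iteratedFDerivWithin_of_isOpen j hS hx]
  refine (B.norm_iteratedFDerivWithin_le_of_bilinear hf.1 hg.1 hS.uniqueDiffOn hx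
    (by exact_mod_cast hj)).trans ?_
  refine mul_le_mul_of_nonneg_left ?_ (norm_nonneg B)
  calc _ ≤ ∑ i ∈ Finset.range (j + 1), (j.choose i : ℝ) * (C₁ * C₂) := by
        refine Finset.sum_le_sum fun i hi => ?_
        rw [Finset.mem_range] at hi
        rw [mul_assoc, iteratedFDerivWithin_of_isOpen _ hS hx,
          iteratedFDerivWithin_of_isOpen _ hS hx]
        gcongr
        · exact hf.2 i (by omega) x hx
        · exact hg.2 (j - i) (by omega) x hx
    _ = 2 ^ j * (C₁ * C₂) := by
        rw [← Finset.sum_mul]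
        congr 1
        exact_mod_cast Nat.sum_range_choose j
    _ ≤ _ := by
        gcongr
        norm_num

/-- The constant of `CkBoundedOn.bilinear`, chosen before the maps. -/
theorem CkBoundedOn.exists_bilinear (B : G →L[ℝ] H →L[ℝ] J) (r : ℕ) (C₁ C₂ : ℝ) :
    ∃ C, ∀ (S : Set E) (f : E → G) (g : E → H), IsOpen S → CkBoundedOn r S C₁ f →
      CkBoundedOn r S C₂ g → CkBoundedOn r S C (fun x => B (f x) (g x)) :=
  ⟨_, fun _ _ _ hS hf hg => hf.bilinear hS B hg⟩

theorem HasCkNormLE.fderiv {r : ℕ} {S : Set E} (hS : IsOpen S) {M : ℝ} {g : E → ℝ}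
    (hg : HasCkNormLE (r + 1) S M g) : CkBoundedOn r S M (fderiv ℝ g) := by
  refine ⟨hg.1.fderiv_of_isOpen hS (by norm_cast), fun j hj x hx => ?_⟩
  rw [norm_iteratedFDeriv_fderiv]
  exact hg.2 (j + 1) (by omega) x hx

/-- A map that is `C^r` near a compact set has bounded derivatives on it. -/
theorem ContDiffOn.exists_ckBoundedOn {r : ℕ} {W K : Set E} (hW : IsOpen W) (hK : IsCompact K)
    (hKW : K ⊆ W) {f : E → G} (hf : ContDiffOn ℝ r f W) : ∃ C, CkBoundedOn r K C f := by
  have h : ∀ j ≤ r, ∃ C, ∀ x ∈ K, ‖iteratedFDeriv ℝ j f x‖ ≤ C := fun j hj =>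
    hK.exists_bound_of_continuousOn (((hf.continuousOn_iteratedFDerivWithin
      (by exact_mod_cast hj) hW.uniqueDiffOn).congr
        (iteratedFDerivWithin_of_isOpen j hW).symm).mono hKW)
  choose! C hC using h
  refine ⟨∑ j ∈ Finset.range (r + 1), |C j|, hf.mono hKW, fun j hj x hx => ?_⟩
  exact ((hC j hj x hx).trans (le_abs_self _)).trans
    (Finset.single_le_sum (f := fun j => |C j|) (fun _ _ => abs_nonneg _)
      (Finset.mem_range.2 (by omega)))

theorem CkBoundedOn.norm_sub_le {r : ℕ} (hr : 1 ≤ r) {S s : Set E} (hS : IsOpen S) {C : ℝ}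
    {f : E → G} (hf : CkBoundedOn r S C f) (hs : Convex ℝ s) (hsS : s ⊆ S) {x y : E} (hx : x ∈ s)
    (hy : y ∈ s) : ‖f x - f y‖ ≤ C * ‖x - y‖ := by
  refine hs.norm_image_sub_le_of_norm_fderiv_le (𝕜 := ℝ) (fun z hz => ?_) (fun z hz => ?_) hy hx
  · exact ((hf.1 z (hsS hz)).contDiffAt (hS.mem_nhds (hsS hz))).differentiableAt
      (by norm_cast; omega)
  · simpa using hf.2 1 hr z (hsS hz)

end CkBounds

/-! ### Derivatives of solutions of slow equations -/

theorem norm_iteratedFDerivWithin_graph_le {E : Type*} [NormedAddCommGroup E] [NormedSpace ℝ E]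
    {S : Set ℝ} (hS : IsOpen S) {ξ : ℝ → E} {m : ℕ} {A : ℝ}
    (hA : 0 ≤ A) (hξ : ContDiffOn ℝ m ξ S) {t : ℝ} (ht : t ∈ S)
    (hb : ∀ i, 1 ≤ i → i ≤ m → ‖iteratedFDerivWithin ℝ i ξ S t‖ ≤ A ^ i)
    {i : ℕ} (hi : 1 ≤ i) (him : i ≤ m) :
    ‖iteratedFDerivWithin ℝ i (fun s => (s, ξ s)) S t‖ ≤ (1 + A) ^ i := by
  have hun : UniqueDiffOn ℝ S := hS.uniqueDiffOn
  have hid : ContDiffOn ℝ m (id : ℝ → ℝ) S := contDiff_id.contDiffOn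
  have hii : ((i : ℕ) : WithTop ℕ∞) ≤ m := by exact_mod_cast him
  have h1 : ‖iteratedFDerivWithin ℝ i (id : ℝ → ℝ) S t‖ ≤ 1 := by
    rw [norm_iteratedFDerivWithin_eq_norm_iteratedDerivWithin]
    obtain ⟨k, rfl⟩ : ∃ k, i = k + 1 := ⟨i - 1, by omega⟩
    rw [iteratedDerivWithin_succ']
    have h : EqOn (derivWithin (id : ℝ → ℝ) S) (fun _ => 1) S := fun s hs =>
      derivWithin_id s S (hun s hs)
    rw [iteratedDerivWithin_congr h ht, iteratedDerivWithin_const]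
    split_ifs <;> simp
  let a : ℝ →L[ℝ] ℝ × E := ContinuousLinearMap.inl ℝ ℝ E
  let b : E →L[ℝ] ℝ × E := ContinuousLinearMap.inr ℝ ℝ E
  have heq : (fun s => (s, ξ s)) = (a ∘ (id : ℝ → ℝ)) + (b ∘ ξ) := by
    funext s
    simp [a, b]
  have ha : ‖a‖ ≤ 1 := ContinuousLinearMap.norm_inl_le_one _ _ _
  have hbn : ‖b‖ ≤ 1 := ContinuousLinearMap.norm_inr_le_one _ _ _
  rw [heq, iteratedFDerivWithin_add_apply
    (((a.contDiff.comp_contDiffOn hid).of_le hii) t ht)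
    (((b.contDiff.comp_contDiffOn hξ).of_le hii) t ht) hun ht]
  calc _ ≤ 1 + A ^ i := by
        refine (norm_add_le _ _).trans (add_le_add ?_ ?_)
        · exact (a.norm_iteratedFDerivWithin_comp_left (hid t ht) hun ht hii).trans
            (mul_le_one₀ ha (norm_nonneg _) h1)
        · exact (b.norm_iteratedFDerivWithin_comp_left (hξ t ht) hun ht hii).trans
            ((mul_le_of_le_one_left (norm_nonneg _) hbn).trans (hb i hi him))
    _ ≤ (1 + A) ^ i := by
        simpa using pow_add_pow_le (zero_le_one) hA (by omega : i ≠ 0)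

/-- Solutions of `ξ' = ε (Ya(ξ) + ε^r Yb(t, ξ))` are slow to the order `r + 1`: although the
perturbation depends on the fast time `t`, its smallness makes the `j`-th derivative of `ξ` of order
`ε^j` for all `j ≤ r + 1`. -/
theorem exists_norm_iteratedFDeriv_solution_le (E : Type*) [NormedAddCommGroup E] [NormedSpace ℝ E]
    (r : ℕ) (C : ℝ) : ∃ A : ℝ, 1 ≤ A ∧ ∀ (ε : ℝ) (S : Set ℝ) (V : Set E) (Ya : E → E)
      (Yb : ℝ × E → E) (ξ : ℝ → E), |ε| ≤ 1 → IsOpen S → IsOpen V →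
      CkBoundedOn r V C Ya → CkBoundedOn r (S ×ˢ V) C Yb → (∀ t ∈ S, ξ t ∈ V) →
      (∀ t ∈ S, HasDerivAt ξ (ε • (Ya (ξ t) + ε ^ r • Yb (t, ξ t))) t) →
      ContDiffOn ℝ (r + 1 : ℕ) ξ S ∧
        ∀ j, 1 ≤ j → j ≤ r + 1 → ∀ t ∈ S, ‖iteratedFDeriv ℝ j ξ t‖ ≤ (A * |ε|) ^ j := by
  suffices H : ∀ m ≤ r + 1, ∃ A : ℝ, 1 ≤ A ∧ ∀ (ε : ℝ) (S : Set ℝ) (V : Set E) (Ya : E → E)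
      (Yb : ℝ × E → E) (ξ : ℝ → E), |ε| ≤ 1 → IsOpen S → IsOpen V →
      CkBoundedOn r V C Ya → CkBoundedOn r (S ×ˢ V) C Yb → (∀ t ∈ S, ξ t ∈ V) →
      (∀ t ∈ S, HasDerivAt ξ (ε • (Ya (ξ t) + ε ^ r • Yb (t, ξ t))) t) →
      ContDiffOn ℝ m ξ S ∧
        ∀ j, 1 ≤ j → j ≤ m → ∀ t ∈ S, ‖iteratedFDeriv ℝ j ξ t‖ ≤ (A * |ε|) ^ j from H _ le_rfl
  intro m
  induction m with
  | zero =>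
    intro _
    refine ⟨1, le_rfl, fun ε S V Ya Yb ξ _ _ _ _ _ _ hd => ⟨?_, fun j h1 h2 => by omega⟩⟩
    exact contDiffOn_zero.2 fun t ht => (hd t ht).continuousAt.continuousWithinAt
  | succ m ih =>
    intro hm
    obtain ⟨A, hA1, hA⟩ := ih (by omega)
    let Q : ℝ := m.factorial * C * A ^ m + m.factorial * C * (1 + A) ^ m
    refine ⟨max A (|Q| + 1), le_max_of_le_left hA1,
      fun ε S V Ya Yb ξ hε hS hV hYa hYb hξV hd => ?_⟩
    obtain ⟨hc, hb⟩ := hA ε S V Ya Yb ξ hε hS hV hYa hYb hξV hd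
    have hun : UniqueDiffOn ℝ S := hS.uniqueDiffOn
    have hA0 : 0 ≤ A := by linarith
    have hmr : ((m : ℕ) : WithTop ℕ∞) ≤ r := by exact_mod_cast (by omega : m ≤ r)
    have hSV : IsOpen (S ×ˢ V) := hS.prod hV
    have hgr : ContDiffOn ℝ m (fun s => (s, ξ s)) S := contDiffOn_id.prodMk hc
    have hma : MapsTo ξ S V := hξV
    have hmb : MapsTo (fun s => (s, ξ s)) S (S ×ˢ V) := fun s hs => ⟨hs, hξV s hs⟩
    have hca : ContDiffOn ℝ m (Ya ∘ ξ) S := (hYa.1.of_le hmr).comp hc hma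
    have hcb : ContDiffOn ℝ m (Yb ∘ fun s => (s, ξ s)) S := (hYb.1.of_le hmr).comp hgr hmb
    have hca' : ContDiffOn ℝ m (ε • (Ya ∘ ξ)) S := hca.const_smul ε
    have hcb' : ContDiffOn ℝ m (ε ^ (r + 1) • (Yb ∘ fun s => (s, ξ s))) S :=
      hcb.const_smul (ε ^ (r + 1))
    have hderiv : EqOn (deriv ξ) (ε • (Ya ∘ ξ) + ε ^ (r + 1) • (Yb ∘ fun s => (s, ξ s))) S := by
      intro t ht
      rw [(hd t ht).deriv]
      simp [smul_smul, pow_succ']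
    have hc' : ContDiffOn ℝ (m + 1 : ℕ) ξ S := by
      rw [Nat.cast_succ, contDiffOn_succ_iff_deriv_of_isOpen hS]
      refine ⟨fun t ht => (hd t ht).differentiableAt.differentiableWithinAt, by simp, ?_⟩
      exact (hca'.add hcb').congr hderiv
    refine ⟨hc', fun j h1 hj t ht => ?_⟩
    rcases hj.lt_or_eq with hj | rfl
    · refine (hb j h1 (by omega) t ht).trans ?_
      gcongr
      exact le_max_left _ _
    have hbW : ∀ i, 1 ≤ i → i ≤ m → ‖iteratedFDerivWithin ℝ i ξ S t‖ ≤ (A * |ε|) ^ i := by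
      intro i h1 hi
      rw [iteratedFDerivWithin_of_isOpen _ hS ht]
      exact hb i h1 hi t ht
    have hba : ‖iteratedFDerivWithin ℝ m (Ya ∘ ξ) S t‖ ≤ m.factorial * C * (A * |ε|) ^ m := by
      refine norm_iteratedFDerivWithin_comp_le (hYa.1.of_le hmr) hc le_rfl hV.uniqueDiffOn hun hma ht
        (fun i hi => ?_) hbW
      rw [iteratedFDerivWithin_of_isOpen _ hV (hξV t ht)]
      exact hYa.2 i (by omega) _ (hξV t ht)
    have hbb : ‖iteratedFDerivWithin ℝ m (Yb ∘ fun s => (s, ξ s)) S t‖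
        ≤ m.factorial * C * (1 + A) ^ m := by
      refine norm_iteratedFDerivWithin_comp_le (hYb.1.of_le hmr) hgr le_rfl hSV.uniqueDiffOn hun hmb
        ht (fun i hi => ?_) (fun i h1 hi => ?_)
      · rw [iteratedFDerivWithin_of_isOpen _ hSV (hmb ht)]
        exact hYb.2 i (by omega) _ (hmb ht)
      · refine norm_iteratedFDerivWithin_graph_le hS hA0 hc ht (fun i h1 hi => ?_) h1 hi
        refine (hbW i h1 hi).trans ?_
        gcongr
        exact mul_le_of_le_one_right hA0 hε
    have hC0 : 0 ≤ C := hYa.nonneg (hξV t ht)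
    have hnorm : ‖iteratedFDeriv ℝ (m + 1) ξ t‖ = ‖iteratedFDerivWithin ℝ m
        (ε • (Ya ∘ ξ) + ε ^ (r + 1) • (Yb ∘ fun s => (s, ξ s))) S t‖ := by
      rw [norm_iteratedFDeriv_eq_norm_iteratedDeriv, iteratedDeriv_succ',
        ← norm_iteratedFDeriv_eq_norm_iteratedDeriv, ← iteratedFDerivWithin_of_isOpen m hS ht,
        iteratedFDerivWithin_congr hderiv ht]
    have hQ0 : 0 ≤ Q := by positivity
    rw [hnorm, iteratedFDerivWithin_add_apply (hca' t ht) (hcb' t ht) hun ht,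
      iteratedFDerivWithin_const_smul_apply (hca t ht) hun ht,
      iteratedFDerivWithin_const_smul_apply (hcb t ht) hun ht]
    calc _ ≤ |ε| * (m.factorial * C * (A * |ε|) ^ m)
          + |ε| ^ (r + 1) * (m.factorial * C * (1 + A) ^ m) := by
          refine (norm_add_le _ _).trans ?_
          rw [norm_smul, norm_smul, norm_pow, Real.norm_eq_abs]
          gcongr
      _ ≤ |ε| * (m.factorial * C * (A * |ε|) ^ m)
          + |ε| ^ (m + 1) * (m.factorial * C * (1 + A) ^ m) := by
          refine add_le_add le_rfl (mul_le_mul_of_nonneg_right ?_ (by positivity))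
          exact pow_le_pow_of_le_one (abs_nonneg _) hε hm
      _ = Q * |ε| ^ (m + 1) := by
          simp only [Q]
          ring
      _ ≤ (max A (|Q| + 1)) ^ (m + 1) * |ε| ^ (m + 1) := by
          gcongr
          calc Q ≤ |Q| + 1 := by linarith [le_abs_self Q]
            _ ≤ max A (|Q| + 1) := le_max_right _ _
            _ ≤ _ := le_self_pow₀ (le_max_of_le_left hA1) (by omega)
      _ = _ := by rw [mul_pow]

/-! ### The error of polynomial interpolation -/

/-- Iterated form of Rolle's theorem: between its `m + 1` zeros `t 0 < ⋯ < t m` the function `f` has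
a zero of its `j`-th derivative for every `j ≤ m`. -/
theorem exists_iteratedDeriv_eq_zero {f : ℝ → ℝ} {a b : ℝ} {m : ℕ}
    (hf : ContDiffOn ℝ m f (Ioo a b)) {t : ℕ → ℝ} (hlt : ∀ i < m, t i < t (i + 1))
    (hmem : ∀ i ≤ m, t i ∈ Ioo a b) (h0 : ∀ i ≤ m, f (t i) = 0) {j : ℕ} (hj : j ≤ m) :
    ∃ c ∈ Ioo a b, iteratedDeriv j f c = 0 := by
  suffices H : ∀ j ≤ m, ∃ s : ℕ → ℝ, (∀ i < m - j, s i < s (i + 1)) ∧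
      ∀ i ≤ m - j, s i ∈ Ioo a b ∧ iteratedDeriv j f (s i) = 0 by
    obtain ⟨s, -, hs⟩ := H j hj
    exact ⟨s 0, hs 0 (Nat.zero_le _)⟩
  intro j
  induction j with
  | zero => exact fun _ => ⟨t, hlt, fun i hi => ⟨hmem i hi, by simpa using h0 i hi⟩⟩
  | succ j ih =>
    intro hj
    obtain ⟨s, hs, hs0⟩ := ih (by omega)
    have hcont : ContinuousOn (iteratedDeriv j f) (Ioo a b) := by
      refine (hf.continuousOn_iteratedDerivWithin (m := j) (by exact_mod_cast (by omega : j ≤ m))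
        isOpen_Ioo.uniqueDiffOn).congr fun x hx => ?_
      exact (iteratedDerivWithin_of_isOpen isOpen_Ioo hx).symm
    have hex : ∀ i < m - j, ∃ c ∈ Ioo (s i) (s (i + 1)), iteratedDeriv (j + 1) f c = 0 := by
      intro i hi
      rw [iteratedDeriv_succ]
      refine exists_deriv_eq_zero (hs i hi) (hcont.mono ?_) ?_
      · exact (convex_Ioo a b).ordConnected.out (hs0 i (by omega)).1 (hs0 (i + 1) (by omega)).1
      · rw [(hs0 i (by omega)).2, (hs0 (i + 1) (by omega)).2]
    choose! c hc hc0 using hex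
    refine ⟨c, fun i hi => ?_, fun i hi => ⟨?_, hc0 i (by omega)⟩⟩
    · exact (hc i (by omega)).2.trans (hc (i + 1) (by omega)).1
    · exact ⟨(hs0 i (by omega)).1.1.trans (hc i (by omega)).1,
        (hc i (by omega)).2.trans (hs0 (i + 1) (by omega)).1.2⟩

/-- If `f` has `m + 1` zeros on an interval, then its first derivative is controlled by its
derivative of order `m + 1`: each derivative in between has a zero. -/
theorem abs_deriv_le_of_zeros {f : ℝ → ℝ} {a b M : ℝ} {m : ℕ}
    (hf : ContDiffOn ℝ (m + 1 : ℕ) f (Ioo a b)) {t : ℕ → ℝ} (hlt : ∀ i < m, t i < t (i + 1))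
    (hmem : ∀ i ≤ m, t i ∈ Ioo a b) (h0 : ∀ i ≤ m, f (t i) = 0)
    (hM : ∀ x ∈ Ioo a b, |iteratedDeriv (m + 1) f x| ≤ M) {x : ℝ} (hx : x ∈ Ioo a b) :
    |deriv f x| ≤ (b - a) ^ m * M := by
  suffices H : ∀ i ≤ m, ∀ x ∈ Ioo a b, |iteratedDeriv (m + 1 - i) f x| ≤ (b - a) ^ i * M by
    simpa using H m le_rfl x hx
  intro i
  induction i with
  | zero => simpa using hM
  | succ i ih =>
    intro hi x hx
    obtain ⟨c, hc, hc0⟩ := exists_iteratedDeriv_eq_zero (j := m + 1 - (i + 1))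
      (hf.of_le (by exact_mod_cast Nat.le_succ m)) hlt hmem h0 (by omega)
    have hab : 0 ≤ b - a := by linarith [hx.1, hx.2]
    have hM0 : 0 ≤ M := (abs_nonneg _).trans (hM x hx)
    have hdiff : ∀ y ∈ Ioo a b, DifferentiableAt ℝ (iteratedDeriv (m + 1 - (i + 1)) f) y := by
      intro y hy
      have h := hf.differentiableOn_iteratedDerivWithin (m := m + 1 - (i + 1))
        (by exact_mod_cast (by omega : m + 1 - (i + 1) < m + 1)) isOpen_Ioo.uniqueDiffOn
      exact (h.congr fun z hz => (iteratedDerivWithin_of_isOpen isOpen_Ioo hz).symm).differentiableAt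
        (isOpen_Ioo.mem_nhds hy)
    have hle := (convex_Ioo a b).norm_image_sub_le_of_norm_deriv_le (𝕜 := ℝ)
      (f := iteratedDeriv (m + 1 - (i + 1)) f) (C := (b - a) ^ i * M) hdiff (fun y hy => ?_) hc hx
    · rw [hc0, sub_zero, Real.norm_eq_abs, Real.norm_eq_abs] at hle
      refine hle.trans ?_
      have : |x - c| ≤ b - a := abs_le.2 ⟨by linarith [hx.1, hc.2], by linarith [hx.2, hc.1]⟩
      calc _ ≤ (b - a) ^ i * M * (b - a) := by gcongr
        _ = _ := by ring
    · rw [← iteratedDeriv_succ, Real.norm_eq_abs,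
        show m + 1 - (i + 1) + 1 = m + 1 - i by omega]
      exact ih (by omega) y hy

theorem Polynomial.iteratedDeriv_eval_eq (p : Polynomial ℝ) (k : ℕ) :
    iteratedDeriv k (fun x => p.eval x) = fun x => (Polynomial.derivative^[k] p).eval x := by
  induction k with
  | zero => simp
  | succ k ih =>
    rw [iteratedDeriv_succ, ih]
    funext x
    rw [Polynomial.deriv, Function.iterate_succ_apply']

/-- The derivative at `0` of the polynomial of degree at most `2 n` that interpolates `g` at the
integers `|k| ≤ n`, compared with that of `g`. -/
theorem abs_deriv_sub_derivative_eval_le {g : ℝ → ℝ} {n : ℕ} {M : ℝ}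
    (hg : ContDiffOn ℝ (2 * n + 1 : ℕ) g (Ioo (-(n + 1 : ℝ)) (n + 1)))
    (hM : ∀ x ∈ Ioo (-(n + 1 : ℝ)) (n + 1), |iteratedDeriv (2 * n + 1) g x| ≤ M)
    {p : Polynomial ℝ} (hp : p.natDegree < 2 * n + 1)
    (hpg : ∀ k : ℤ, -(n : ℤ) ≤ k → k ≤ n → p.eval (k : ℝ) = g k) :
    |deriv g 0 - p.derivative.eval 0| ≤ (2 * (n + 1)) ^ (2 * n) * M := by
  have hn : (0 : ℝ) ≤ n := n.cast_nonneg
  have h0 : (0 : ℝ) ∈ Ioo (-(n + 1 : ℝ)) (n + 1) := ⟨by linarith, by linarith⟩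
  have hpc : ContDiff ℝ (2 * n + 1 : ℕ) fun x : ℝ => p.eval x := by
    simpa using p.contDiff_aeval (𝕜 := ℝ) (2 * n + 1 : ℕ)
  have hgat : ∀ x ∈ Ioo (-(n + 1 : ℝ)) (n + 1), ContDiffAt ℝ (2 * n + 1 : ℕ) g x := fun x hx =>
    hg.contDiffAt (isOpen_Ioo.mem_nhds hx)
  have hp0 : ∀ x, iteratedDeriv (2 * n + 1) (fun x : ℝ => p.eval x) x = 0 := by
    intro x
    rw [Polynomial.iteratedDeriv_eval_eq, Polynomial.iterate_derivative_eq_zero hp]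
    exact Polynomial.eval_zero
  have key := abs_deriv_le_of_zeros (f := g - fun x => p.eval x) (m := 2 * n) (M := M)
    (a := -(n + 1 : ℝ)) (b := n + 1) (t := fun i => -(n : ℝ) + i) (hg.sub hpc.contDiffOn)
    (fun i _ => by push_cast; linarith) (fun i hi => ?_) (fun i hi => ?_) (fun x hx => ?_) h0
  · rw [deriv_sub ((hgat 0 h0).differentiableAt (by norm_cast)) p.differentiable.differentiableAt,
      Polynomial.deriv] at key
    refine key.trans_eq ?_
    ring_nf
  · have : (i : ℝ) ≤ 2 * n := by exact_mod_cast hi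
    have h2 : (0 : ℝ) ≤ i := i.cast_nonneg
    constructor <;> linarith
  · have := hpg (-(n : ℤ) + i) (by omega) (by omega)
    push_cast at this
    simp [this]
  · rw [iteratedDeriv_sub (hgat x hx) hpc.contDiffAt, hp0, sub_zero]
    exact hM x hx

theorem PhaseSpace.norm_le_of_forall_abs_le {d : ℕ} {v : PhaseSpace d} {M : ℝ}
    (h : ∀ i, |v i| ≤ M) : ‖v‖ ≤ (2 * d : ℕ) * M := by
  have hv : v = ∑ i, EuclideanSpace.single i (v i) := by
    ext j
    simp [Finset.sum_apply]
  calc ‖v‖ = ‖∑ i, EuclideanSpace.single i (v i)‖ := by rw [← hv]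
    _ ≤ ∑ i : Fin (2 * d), M := (norm_sum_le _ _).trans
        (Finset.sum_le_sum fun i _ => by simpa using h i)
    _ = _ := by simp

/-- If `ξ` runs through the iterates `x_k` at the times `k`, then `ε X_n(x)` is its velocity at
time `0` up to the size of its derivative of order `2 n + 1`. -/
theorem norm_deriv_sub_interpolatingField_le {d : ℕ} {D : Set (PhaseSpace d)} {n : ℕ} {ε : ℝ}
    (hε : ε ≠ 0) {f : PhaseSpace d → PhaseSpace d} {x : PhaseSpace d} {ξ : ℝ → PhaseSpace d}
    (hξ : ContDiffOn ℝ (2 * n + 1 : ℕ) ξ (Ioo (-(n + 1 : ℝ)) (n + 1))) {M : ℝ}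
    (hM : ∀ t ∈ Ioo (-(n + 1 : ℝ)) (n + 1), ‖iteratedFDeriv ℝ (2 * n + 1) ξ t‖ ≤ M)
    (hit : ∀ k : ℤ, -(n : ℤ) ≤ k → k ≤ n → iterateZ D f k x = ξ k) :
    ‖deriv ξ 0 - ε • interpolatingField D n ε f x‖
      ≤ (2 * d : ℕ) * ((2 * (n + 1)) ^ (2 * n) * M) := by
  refine PhaseSpace.norm_le_of_forall_abs_le fun i => ?_
  let π : PhaseSpace d →L[ℝ] ℝ := EuclideanSpace.proj i
  have hπ : ‖π‖ ≤ 1 := by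
    refine π.opNorm_le_bound zero_le_one fun v => ?_
    rw [one_mul]
    exact PiLp.norm_apply_le v i
  have hξat : ∀ t ∈ Ioo (-(n + 1 : ℝ)) (n + 1), ContDiffAt ℝ (2 * n + 1 : ℕ) ξ t := fun t ht =>
    hξ.contDiffAt (isOpen_Ioo.mem_nhds ht)
  have hn : (0 : ℝ) ≤ n := n.cast_nonneg
  have h0 : (0 : ℝ) ∈ Ioo (-(n + 1 : ℝ)) (n + 1) := ⟨by linarith, by linarith⟩
  have hinj : Set.InjOn (fun k : ℤ => ε * (k : ℝ)) (Finset.Icc (-(n : ℤ)) n) := by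
    intro k _ l _ hkl
    exact_mod_cast mul_left_cancel₀ hε hkl
  have hcard : (Finset.Icc (-(n : ℤ)) n).card = 2 * n + 1 := by
    rw [Int.card_Icc]
    omega
  set P := interpolatingPolynomial D n ε f x i with hP
  have hPdeg : P.natDegree < 2 * n + 1 := by
    have h : P.degree < (2 * n + 1 : ℕ) := by
      rw [← hcard]
      exact Lagrange.degree_interpolate_lt _ hinj
    by_cases hP0 : P = 0
    · simp [hP0]
    · exact (Polynomial.natDegree_lt_iff_degree_lt hP0).2 h
  have hPdeg' : (P.comp (Polynomial.C ε * Polynomial.X)).natDegree < 2 * n + 1 := by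
    rwa [Polynomial.natDegree_comp, Polynomial.natDegree_C_mul_X _ hε, mul_one]
  have key := abs_deriv_sub_derivative_eval_le (g := π ∘ ξ) (π.contDiff.comp_contDiffOn hξ)
    (M := M) (fun t ht => ?_) hPdeg' (fun k h1 h2 => ?_)
  · have hd : deriv (π ∘ ξ) 0 = π (deriv ξ 0) :=
      (π.hasFDerivAt.comp_hasDerivAt 0
        ((hξat 0 h0).differentiableAt (by norm_cast)).hasDerivAt).deriv
    rw [hd] at key
    simpa [Polynomial.derivative_comp, interpolatingField, π] using key
  · rw [← Real.norm_eq_abs, ← norm_iteratedFDeriv_eq_norm_iteratedDeriv]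
    exact (π.norm_iteratedFDeriv_comp_left (hξat t ht) le_rfl).trans
      ((mul_le_of_le_one_left (norm_nonneg _) hπ).trans (hM t ht))
  · have := Lagrange.eval_interpolate_at_node (fun k : ℤ => iterateZ D f k x i) hinj
      (Finset.mem_Icc.2 ⟨h1, h2⟩)
    simp only [Polynomial.eval_comp, Polynomial.eval_mul, Polynomial.eval_C, Polynomial.eval_X]
    rw [hP, interpolatingPolynomial, this, hit k h1 h2]
    rfl

/-- The interpolating field is a linear combination of the iterates, hence as continuous in `x` as
these are. -/
theorem continuousAt_interpolatingField {d : ℕ} {D : Set (PhaseSpace d)} {n : ℕ} {ε : ℝ}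
    {f : PhaseSpace d → PhaseSpace d} {x : PhaseSpace d}
    (h : ∀ k : ℤ, -(n : ℤ) ≤ k → k ≤ n → ContinuousAt (iterateZ D f k) x) :
    ContinuousAt (interpolatingField D n ε f) x := by
  have hc : ContinuousAt (fun y (i : Fin (2 * d)) =>
      (interpolatingPolynomial D n ε f y i).derivative.eval 0) x := by
    refine continuousAt_pi.2 fun i => ?_
    simp only [interpolatingPolynomial, Lagrange.interpolate_apply, Polynomial.derivative_sum,
      Polynomial.derivative_mul, Polynomial.derivative_C, zero_mul, zero_add,
      Polynomial.eval_finsetSum, Polynomial.eval_mul, Polynomial.eval_C]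
    refine tendsto_finsetSum _ fun k hk => ?_
    rw [Finset.mem_Icc] at hk
    refine ContinuousAt.mul ?_ continuousAt_const
    exact (EuclideanSpace.proj (𝕜 := ℝ) i).continuous.continuousAt.comp (h k hk.1 hk.2)
  exact (PiLp.continuous_toLp 2 _).continuousAt.comp hc

/-! ### Integrals along piecewise smooth paths -/

section Curves

variable {d : ℕ} {a b : PhaseSpace d} {γ : Path a b}

theorem IsPiecewiseSmooth.intervalIntegrable (hγ : IsPiecewiseSmooth γ)
    {Φ : PhaseSpace d → PhaseSpace d → ℝ}
    (hΦ : ContinuousOn (Function.uncurry Φ) (range γ ×ˢ univ)) :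
    IntervalIntegrable (fun s => Φ (γ.extend s) (derivWithin γ.extend I s)) MeasureTheory.volume
      0 1 := by
  obtain ⟨N, t, ht, h0, h1, hγ⟩ := hγ
  rw [← h0, ← h1]
  refine IntervalIntegrable.trans_iterate fun k hk => ?_
  rcases (ht k.le_succ).eq_or_lt with heq | hlt
  · rw [heq]
  have hsub : Icc (t k) (t (k + 1)) ⊆ Icc 0 1 :=
    Icc_subset_Icc (h0 ▸ ht k.zero_le) (h1 ▸ ht (by omega))
  have hder : ContinuousOn (derivWithin γ.extend (Icc (t k) (t (k + 1)))) (Icc (t k) (t (k + 1))) :=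
    (hγ k hk).continuousOn_derivWithin (uniqueDiffOn_Icc hlt) le_rfl
  have hc : ContinuousOn (fun s => Function.uncurry Φ
      (γ.extend s, derivWithin γ.extend (Icc (t k) (t (k + 1))) s)) (Icc (t k) (t (k + 1))) := by
    refine hΦ.comp (γ.continuous_extend.continuousOn.prodMk hder) fun s hs => ⟨?_, mem_univ _⟩
    rw [← γ.extend_range]
    exact mem_range_self s
  -- Inside the piece both one-sided notions of derivative are the derivative.
  refine ((hc.intervalIntegrable_of_Icc hlt.le).congr_ae ?_)
  rw [uIoc_of_le hlt.le, ← MeasureTheory.restrict_Ioo_eq_restrict_Ioc]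
  refine (MeasureTheory.ae_restrict_iff' measurableSet_Ioo).2
    (MeasureTheory.ae_of_all _ fun s hs => ?_)
  have h01 := hsub (Ioo_subset_Icc_self hs)
  have hI : (I : Set ℝ) ∈ 𝓝 s := mem_of_superset (Icc_mem_nhds hs.1 hs.2) hsub
  simp only [Function.uncurry]
  rw [derivWithin_of_mem_nhds hI, derivWithin_of_mem_nhds (Icc_mem_nhds hs.1 hs.2)]

theorem IsPiecewiseSmooth.curveIntegrable (hγ : IsPiecewiseSmooth γ)
    {ν : PhaseSpace d → PhaseSpace d →L[ℝ] ℝ} (hν : ContinuousOn ν (range γ)) :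
    CurveIntegrable ν γ := by
  have h := hγ.intervalIntegrable (Φ := fun x v => ν x v)
    ((hν.comp continuousOn_fst fun _ hp => hp.1).clm_apply continuousOn_snd)
  simpa only [CurveIntegrable, funext (curveIntegralFun_def ν γ)] using h

theorem IsPiecewiseSmooth.curveIntegral_fderiv (hγ : IsPiecewiseSmooth γ) {g : PhaseSpace d → ℝ}
    {U : Set (PhaseSpace d)} (hU : IsOpen U) (hg : ContDiffOn ℝ 1 g U) (hγU : ∀ s, γ s ∈ U) :
    curveIntegral (fderiv ℝ g) γ = g b - g a := by
  have hν : ContinuousOn (fderiv ℝ g) (range γ) :=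
    (hg.continuousOn_fderiv_of_isOpen hU le_rfl).mono (range_subset_iff.2 hγU)
  have hint := hγ.curveIntegrable hν
  obtain ⟨N, t, ht, h0, h1, hγ⟩ := hγ
  rw [CurveIntegrable] at hint
  have hmem : ∀ s, γ.extend s ∈ U := fun s => hγU _
  rw [curveIntegral_def, MeasureTheory.integral_eq_of_hasDerivAt_off_countable_of_le
    (g ∘ γ.extend) _ zero_le_one (s := t '' Iic N) ((finite_Iic N).image t).countable ?_ ?_ hint]
  · simp
  · exact hg.continuousOn.comp γ.continuous_extend.continuousOn fun s _ => hmem s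
  · rintro s ⟨hs, hst⟩
    obtain ⟨k, hk, hks⟩ : ∃ k < N, s ∈ Ioo (t k) (t (k + 1)) := by
      have hex : ∃ k, s < t k := ⟨N, by rw [h1]; exact hs.2⟩
      classical
      have hk := Nat.find_spec hex
      have hkN : Nat.find hex ≤ N := Nat.find_min' hex (by rw [h1]; exact hs.2)
      have hk0 : Nat.find hex ≠ 0 := by
        intro h
        rw [h, h0] at hk
        exact absurd hs.1 hk.not_gt
      obtain ⟨k, hk'⟩ := Nat.exists_eq_succ_of_ne_zero hk0
      rw [hk', Nat.succ_eq_add_one] at hk hkN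
      refine ⟨k, by omega, lt_of_le_of_ne ?_ ?_, hk⟩
      · exact not_lt.1 (Nat.find_min hex (by omega))
      · exact fun h => hst ⟨k, by simp; omega, h⟩
    have hnhds := Icc_mem_nhds hks.1 hks.2
    have hI : (I : Set ℝ) ∈ 𝓝 s := Icc_mem_nhds hs.1 hs.2
    have hd : HasDerivAt γ.extend (deriv γ.extend s) s :=
      (((hγ k hk).contDiffAt hnhds).differentiableAt one_ne_zero).hasDerivAt
    have hgd : HasFDerivAt g (fderiv ℝ g (γ.extend s)) (γ.extend s) :=
      ((hg.contDiffAt (hU.mem_nhds (hmem s))).differentiableAt one_ne_zero).hasFDerivAt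
    rw [curveIntegralFun_def, derivWithin_of_mem_nhds hI]
    exact hgd.comp_hasDerivAt s hd

theorem IsPiecewiseSmooth.abs_curveIntegral_le (hγ : IsPiecewiseSmooth γ)
    {ν : PhaseSpace d → PhaseSpace d →L[ℝ] ℝ} {c : ℝ} (hc : ∀ s, ‖ν (γ s)‖ ≤ c) :
    |curveIntegral ν γ| ≤ c * pathLength γ := by
  rw [curveIntegral_def, pathLength, ← intervalIntegral.integral_const_mul, ← Real.norm_eq_abs]
  refine intervalIntegral.norm_integral_le_of_norm_le zero_le_one
    (MeasureTheory.ae_of_all _ fun s _ => ?_) ?_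
  · rw [curveIntegralFun_def]
    refine ((ν _).le_opNorm _).trans ?_
    gcongr
    exact hc _
  · exact (hγ.intervalIntegrable (Φ := fun _ v => ‖v‖)
      (continuous_snd.norm.continuousOn)).const_mul c

theorem IsPiecewiseSmooth.abs_curveIntegral_sub_le (hγ : IsPiecewiseSmooth γ)
    {ν : PhaseSpace d → PhaseSpace d →L[ℝ] ℝ} (hν : ContinuousOn ν (range γ))
    {g : PhaseSpace d → ℝ} {U : Set (PhaseSpace d)} (hU : IsOpen U) (hg : ContDiffOn ℝ 1 g U)
    (hγU : ∀ s, γ s ∈ U) {c : ℝ} (hc : ∀ s, ‖ν (γ s) - fderiv ℝ g (γ s)‖ ≤ c) :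
    |curveIntegral ν γ - (g b - g a)| ≤ c * pathLength γ := by
  have hdg : ContinuousOn (fderiv ℝ g) (range γ) :=
    (hg.continuousOn_fderiv_of_isOpen hU le_rfl).mono (range_subset_iff.2 hγU)
  rw [← hγ.curveIntegral_fderiv hU hg hγU,
    ← curveIntegral_sub (hγ.curveIntegrable hν) (hγ.curveIntegrable hdg)]
  exact hγ.abs_curveIntegral_le hc

end Curves

/-! ### The flow of the suspension and the iterates -/

/-- The local flow of the Picard–Lindelöf theorem, which depends in a Lipschitz way on the initial
point, together with the information that it stays in the ball where the field is controlled. -/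
theorem IsPicardLindelof.exists_flow_mem_closedBall {E : Type*} [NormedAddCommGroup E]
    [NormedSpace ℝ E] [CompleteSpace E] {f : ℝ → E → E} {tmin tmax : ℝ} {t₀ : Icc tmin tmax}
    {x₀ : E} {a r L K : NNReal} (hf : IsPicardLindelof f t₀ x₀ a r L K) :
    ∃ α : E → ℝ → E, (∀ x ∈ Metric.closedBall x₀ r, α x t₀ = x ∧
      (∀ t ∈ Icc tmin tmax, α x t ∈ Metric.closedBall x₀ a) ∧
      ∀ t ∈ Icc tmin tmax, HasDerivWithinAt (α x) (f t (α x t)) (Icc tmin tmax) t) ∧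
      ∃ L' : NNReal, ∀ t ∈ Icc tmin tmax, LipschitzOnWith L' (α · t) (Metric.closedBall x₀ r) := by
  classical
  have (x) (hx : x ∈ Metric.closedBall x₀ r) := ODE.FunSpace.exists_isFixedPt_next hf hx
  choose α hα using this
  let α' : E → ℝ → E := fun x =>
    if hx : x ∈ Metric.closedBall x₀ r then (α x hx).compProj else 0
  have hα' : ∀ x (hx : x ∈ Metric.closedBall x₀ r), α' x = (α x hx).compProj := fun x hx =>
    dif_pos hx
  refine ⟨α', fun x hx => ⟨?_, fun t _ => ?_, fun t ht => ?_⟩, ?_⟩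
  · rw [hα' x hx, ODE.FunSpace.compProj_val, ← hα, ODE.FunSpace.next_apply₀]
  · rw [hα' x hx]
    exact (α x hx).compProj_mem_closedBall hf.mul_max_le
  · rw [hα' x hx, ODE.FunSpace.compProj_apply]
    apply ODE.hasDerivWithinAt_picard_Icc t₀.2 hf.continuousOn_uncurry
      (α x hx).continuous_compProj.continuousOn
      (fun _ _ => (α x hx).compProj_mem_closedBall hf.mul_max_le) x ht |>.congr_of_mem _ ht
    intro t' ht'
    nth_rw 1 [← hα]
    rw [ODE.FunSpace.compProj_of_mem ht', ODE.FunSpace.next_apply]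
  · obtain ⟨L', h⟩ := ODE.FunSpace.exists_forall_closedBall_funSpace_dist_le_mul hf
    refine ⟨L', fun t ht => LipschitzOnWith.of_dist_le_mul fun x hx y hy => ?_⟩
    rw [hα' x hx, hα' y hy, ODE.FunSpace.compProj_apply, ODE.FunSpace.compProj_apply,
      ← ODE.FunSpace.toContinuousMap_apply_eq_apply, ← ODE.FunSpace.toContinuousMap_apply_eq_apply]
    have : Nonempty (Icc tmin tmax) := ⟨t₀⟩
    exact ContinuousMap.dist_le_iff_of_nonempty.mp (h x y hx hy (α x hx) (α y hy) (hα x hx)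
      (hα y hy)) _

theorem localInverse_eq_of_unique {d : ℕ} {D : Set (PhaseSpace d)}
    {f : PhaseSpace d → PhaseSpace d} {x y : PhaseSpace d} (hy : y ∈ D) (hfy : f y = x)
    (huniq : ∀ z ∈ D, f z = x → dist z x ≤ dist y x → z = y) : localInverse D f x = y := by
  have h : ∃ w, (w ∈ D ∧ f w = x) ∧ ∀ z ∈ D, f z = x → dist w x ≤ dist z x := by
    refine ⟨y, ⟨hy, hfy⟩, fun z hz hfz => ?_⟩
    by_contra hlt
    rw [huniq z hz hfz (not_le.1 hlt).le] at hlt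
    exact hlt le_rfl
  have h' := Classical.epsilon_spec h
  exact huniq _ h'.1.1 h'.1.2 (h'.2 y hy hfy)

/-- Near a point `x₀` the iterates of `f` up to order `n` are the values of the flow of its
suspension `ε Y` at integer times. The field is assumed to be so small that orbits hardly move, so
that the closest preimage of a point is the one on its orbit. -/
theorem IsSuspensionOn.exists_orbit {d n : ℕ} {D U : Set (PhaseSpace d)} {ε a : ℝ} {K L : NNReal}
    {f : PhaseSpace d → PhaseSpace d} {Y : ℝ → PhaseSpace d → PhaseSpace d}
    (hsusp : IsSuspensionOn U ε f Y) (hUD : U ⊆ D) {x₀ : PhaseSpace d} (ha : 0 < a)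
    (hball : Metric.closedBall x₀ a ⊆ U)
    (hL : ∀ τ ∈ Icc (-(n + 1 : ℝ)) (n + 1), ∀ x ∈ Metric.closedBall x₀ a, ‖Y τ x‖ ≤ L)
    (hK : ∀ τ ∈ Icc (-(n + 1 : ℝ)) (n + 1), LipschitzOnWith K (Y τ) (Metric.closedBall x₀ a))
    (hc : ∀ x ∈ Metric.closedBall x₀ a,
      ContinuousOn (fun τ => Y τ x) (Icc (-(n + 1 : ℝ)) (n + 1)))
    (hε : |ε| * L * (n + 1) ≤ a / 16) :
    ∃ ξ : ℝ → PhaseSpace d, ξ 0 = x₀ ∧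
      (∀ τ ∈ Icc (-(n + 1 : ℝ)) (n + 1), ξ τ ∈ Metric.closedBall x₀ a ∧
        HasDerivWithinAt ξ (ε • Y τ (ξ τ)) (Icc (-(n + 1 : ℝ)) (n + 1)) τ) ∧
      HasIterates D f n x₀ ∧
      ∀ k : ℤ, -(n : ℤ) ≤ k → k ≤ n → iterateZ D f k x₀ = ξ k ∧
        ContinuousAt (iterateZ D f k) x₀ := by
  have hn : (0 : ℝ) ≤ n := n.cast_nonneg
  set J : Set ℝ := Icc (-(n + 1 : ℝ)) (n + 1) with hJ
  have h0J : (0 : ℝ) ∈ J := ⟨by linarith, by linarith⟩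
  -- The field `ε Y` satisfies the hypotheses of the Picard–Lindelöf theorem.
  have hPL : IsPicardLindelof (fun τ x => ε • Y τ x) (tmin := -(n + 1 : ℝ)) (tmax := n + 1)
      ⟨0, h0J⟩ x₀ ⟨a, ha.le⟩ ⟨a / 2, by positivity⟩ (‖ε‖₊ * L) (‖ε‖₊ * K) := by
    refine ⟨fun τ hτ => ?_, fun x hx => (hc x hx).const_smul ε, fun τ hτ x hx => ?_, ?_⟩
    · exact (lipschitzWith_smul ε).comp_lipschitzOnWith (hK τ hτ)
    · rw [norm_smul]
      push_cast
      gcongr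
      exact hL τ hτ x hx
    · have : max ((n : ℝ) + 1 - 0) (0 - -(n + 1 : ℝ)) = n + 1 := by simp
      simp only [NNReal.coe_mul, coe_nnnorm, Real.norm_eq_abs]
      rw [this]
      change |ε| * L * (n + 1) ≤ a - a / 2
      linarith
  obtain ⟨α, hα, L', hL'⟩ := hPL.exists_flow_mem_closedBall
  change ∀ z ∈ Metric.closedBall x₀ (a / 2), α z 0 = z ∧
    (∀ τ ∈ J, α z τ ∈ Metric.closedBall x₀ a) ∧ _ at hα
  -- Orbits move by at most `a / 16`.
  have hdist : ∀ z ∈ Metric.closedBall x₀ (a / 2), ∀ τ ∈ J, dist (α z τ) z ≤ a / 16 := by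
    intro z hz τ hτ
    obtain ⟨hz0, hzm, hzd⟩ := hα z hz
    have h := (convex_Icc (-(n + 1 : ℝ)) (n + 1)).norm_image_sub_le_of_norm_hasDerivWithin_le
      (C := |ε| * L) hzd (fun t ht => ?_) h0J hτ
    · rw [hz0, sub_zero, ← dist_eq_norm] at h
      refine h.trans (le_trans ?_ hε)
      gcongr
      exact abs_le.2 hτ
    · rw [norm_smul, Real.norm_eq_abs]
      gcongr
      exact hL t ht _ (hzm t ht)
  have hper : ∀ (k : ℤ) (s : ℝ), ∀ x ∈ U, Y (k + s) x = Y s x := by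
    intro k s x hx
    have h : Function.Periodic (fun τ => Y τ x) 1 := fun τ => hsusp.1 τ x hx
    have := h.int_mul k s
    rwa [mul_one, add_comm] at this
  -- By periodicity, an orbit that is translated by an integer is an orbit.
  have hshift : ∀ z ∈ Metric.closedBall x₀ (a / 2), ∀ k : ℤ, -(n + 1 : ℤ) ≤ k → k ≤ n →
      ∀ s ∈ Icc (0 : ℝ) 1, α z (k + s) ∈ Metric.closedBall x₀ a ∧
        HasDerivWithinAt (fun s => α z (k + s)) (ε • Y s (α z (k + s))) (Icc 0 1) s := by
    intro z hz k hk1 hk2 s hs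
    obtain ⟨-, hzm, hzd⟩ := hα z hz
    have hk1' : -(n + 1 : ℝ) ≤ k := by exact_mod_cast hk1
    have hk2' : (k : ℝ) ≤ n := by exact_mod_cast hk2
    have hmaps : MapsTo (fun s : ℝ => (k : ℝ) + s) (Icc 0 1) J := fun s hs =>
      ⟨by linarith [hs.1], by linarith [hs.2]⟩
    refine ⟨hzm _ (hmaps hs), ?_⟩
    have h := (hzd _ (hmaps hs)).scomp s (((hasDerivAt_id s).const_add (k : ℝ)).hasDerivWithinAt)
      hmaps
    rw [one_smul, hper k s _ (hball (hzm _ (hmaps hs)))] at h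
    exact h
  have hstep : ∀ z ∈ Metric.closedBall x₀ (a / 2), ∀ k : ℤ, -(n + 1 : ℤ) ≤ k → k ≤ n →
      f (α z k) = α z (k + 1) := by
    intro z hz k hk1 hk2
    have h := hsusp.2 (fun s => α z (k + s)) fun s hs =>
      ⟨hball (hshift z hz k hk1 hk2 s hs).1, (hshift z hz k hk1 hk2 s hs).2⟩
    simpa using h.symm
  have hfor : ∀ z ∈ Metric.closedBall x₀ (a / 4), ∀ j : ℕ, j ≤ n + 1 → f^[j] z = α z j := by
    intro z hz j
    have hz2 := Metric.closedBall_subset_closedBall (by linarith : a / 4 ≤ a / 2) hz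
    induction j with
    | zero => simpa using (hα z hz2).1.symm
    | succ j ih =>
      intro hj
      rw [Function.iterate_succ_apply', ih (by omega)]
      have := hstep z hz2 j (by omega) (by omega)
      push_cast at this ⊢
      exact this
  have hback : ∀ z ∈ Metric.closedBall x₀ (a / 4), ∀ j : ℕ, j ≤ n →
      (localInverse D f)^[j] z = α z (-j) := by
    intro z hz j
    have hz2 := Metric.closedBall_subset_closedBall (by linarith : a / 4 ≤ a / 2) hz
    induction j with
    | zero => simpa using (hα z hz2).1.symm
    | succ j ih =>
      intro hj
      rw [Function.iterate_succ_apply', ih (by omega)]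
      have hjn : (j : ℝ) + 1 ≤ n := by exact_mod_cast hj
      have hj0 : (0 : ℝ) ≤ j := j.cast_nonneg
      have hk1 : -(n + 1 : ℤ) ≤ -(j + 1 : ℤ) := by omega
      have hk2 : -(j + 1 : ℤ) ≤ (n : ℤ) := by omega
      have hm1 : -(j : ℝ) ∈ J := ⟨by linarith, by linarith⟩
      have hm2 : -((j : ℝ) + 1) ∈ J := ⟨by linarith, by linarith⟩
      have hs := hstep z hz2 (-(j + 1 : ℤ)) hk1 hk2
      have hsh := hshift z hz2 (-(j + 1 : ℤ)) hk1 hk2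
      push_cast at hs hsh ⊢
      rw [show -((j : ℝ) + 1) + 1 = -j by ring] at hs
      refine localInverse_eq_of_unique (hUD (hball ((hα z hz2).2.1 _ hm2))) hs
        fun w _ hw hwd => ?_
      -- A preimage that is as close is in the ball; its orbit has the same value at time `1`.
      have h1 := hdist z hz2 _ hm1
      have h2 := hdist z hz2 _ hm2
      have hw2 : w ∈ Metric.closedBall x₀ (a / 2) := by
        rw [Metric.mem_closedBall] at hz ⊢
        have t1 := dist_triangle w (α z (-(j : ℝ))) x₀
        have t2 := dist_triangle (α z (-(j : ℝ))) z x₀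
        have t3 := dist_triangle_right (α z (-((j : ℝ) + 1))) (α z (-(j : ℝ))) z
        linarith
      have hsw := hshift w hw2 0 (by omega) (by omega)
      have hfw := hstep w hw2 0 (by omega) (by omega)
      simp only [Int.cast_zero, zero_add] at hsw hfw
      rw [(hα w hw2).1, hw] at hfw
      have huni := ODE_solution_unique_of_mem_Icc_left (v := fun s x => ε • Y s x)
        (s := fun _ => Metric.closedBall x₀ a) (K := ‖ε‖₊ * K) (a := 0) (b := 1)
        (f := fun s => α w s) (g := fun s => α z (-((j : ℝ) + 1) + s))
        (fun t ht => hPL.lipschitzOnWith t ⟨by linarith [ht.1], by linarith [ht.2]⟩)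
        (fun t ht => (hsw t ht).2.continuousWithinAt)
        (fun t ht => (hsw t (Ioc_subset_Icc_self ht)).2.mono_of_mem_nhdsWithin
          (Icc_mem_nhdsLE_of_mem ht))
        (fun t ht => (hsw t (Ioc_subset_Icc_self ht)).1)
        (fun t ht => (hsh t ht).2.continuousWithinAt)
        (fun t ht => (hsh t (Ioc_subset_Icc_self ht)).2.mono_of_mem_nhdsWithin
          (Icc_mem_nhdsLE_of_mem ht))
        (fun t ht => (hsh t (Ioc_subset_Icc_self ht)).1)
        (by
          rw [← hfw, show -((j : ℝ) + 1) + 1 = -j by ring])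
      have := huni (left_mem_Icc.2 zero_le_one)
      simpa [(hα w hw2).1] using this
  have hit : ∀ z ∈ Metric.closedBall x₀ (a / 4), ∀ k : ℤ, -(n : ℤ) ≤ k → k ≤ n →
      iterateZ D f k z = α z k := by
    intro z hz k hk1 hk2
    unfold iterateZ
    split_ifs with hk
    · obtain ⟨j, rfl⟩ := Int.eq_ofNat_of_zero_le hk
      simpa using hfor z hz j (by omega)
    · obtain ⟨j, hj⟩ := Int.eq_ofNat_of_zero_le (by omega : 0 ≤ -k)
      obtain rfl : k = -(j : ℤ) := by omega
      simpa using hback z hz j (by omega)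
  have hx4 : x₀ ∈ Metric.closedBall x₀ (a / 4) := Metric.mem_closedBall_self (by positivity)
  have hx2 : x₀ ∈ Metric.closedBall x₀ (a / 2) := Metric.mem_closedBall_self (by positivity)
  have hkJ : ∀ k : ℤ, -(n : ℤ) ≤ k → k ≤ n → (k : ℝ) ∈ J := by
    intro k hk1 hk2
    have h1 : -(n : ℝ) ≤ k := by exact_mod_cast hk1
    have h2 : (k : ℝ) ≤ n := by exact_mod_cast hk2
    exact ⟨by linarith, by linarith⟩
  refine ⟨α x₀, (hα x₀ hx2).1, fun τ hτ => ⟨(hα x₀ hx2).2.1 τ hτ, (hα x₀ hx2).2.2 τ hτ⟩,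
    ⟨fun k hk1 hk2 => ?_, fun k hk1 hk2 => ?_⟩, fun k hk1 hk2 => ⟨hit x₀ hx4 k hk1 hk2, ?_⟩⟩
  · rw [hit x₀ hx4 k hk1 hk2]
    exact hUD (hball ((hα x₀ hx2).2.1 _ (hkJ k hk1 hk2)))
  · rw [hit x₀ hx4 k hk1 hk2.le, hit x₀ hx4 (k + 1) (by omega) (by omega),
      hstep x₀ hx2 k (by omega) hk2.le]
    push_cast
    rfl
  · have hnhds : Metric.closedBall x₀ (a / 4) ∈ 𝓝 x₀ :=
      Metric.closedBall_mem_nhds x₀ (by positivity)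
    have hcont : ContinuousAt (fun z => α z k) x₀ :=
      (hL' k (hkJ k hk1 hk2)).continuousOn.continuousAt
        (Metric.closedBall_mem_nhds x₀ (half_pos ha))
    refine hcont.congr ?_
    filter_upwards [hnhds] with z hz
    exact (hit z hz k hk1 hk2).symm

/-! ### The Hamiltonian vector field -/

/-- The map `u ↦ ω(u, ·)` of a bilinear form, as a continuous linear map depending linearly on
`ω`. -/
noncomputable def flatForm (d : ℕ) : (PhaseSpace d [⋀^Fin 2]→L[ℝ] ℝ) →L[ℝ]
    (PhaseSpace d →L[ℝ] (PhaseSpace d →L[ℝ] ℝ)) :=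
  (ContinuousLinearMap.compL ℝ (PhaseSpace d) (PhaseSpace d [⋀^Fin 1]→L[ℝ] ℝ)
      (PhaseSpace d →L[ℝ] ℝ)
    (ContinuousAlternatingMap.ofSubsingletonLIE (𝕜 := ℝ) (E := PhaseSpace d) (F := ℝ)
      (0 : Fin 1)).symm.toContinuousLinearEquiv.toContinuousLinearMap) ∘L
    (ContinuousAlternatingMap.curryLeftLI (𝕜 := ℝ) (E := PhaseSpace d) (F := ℝ)
      (n := 1)).toContinuousLinearMap

theorem flatForm_apply {d : ℕ} (ω : PhaseSpace d [⋀^Fin 2]→L[ℝ] ℝ) (u : PhaseSpace d) :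
    flatForm d ω u = contractForm ω u :=
  rfl

theorem contractForm_self {d : ℕ} (ω : PhaseSpace d [⋀^Fin 2]→L[ℝ] ℝ) (u : PhaseSpace d) :
    contractForm ω u u = 0 := by
  rw [contractForm_apply]
  exact ω.map_eq_zero_of_eq ![u, u] (i := 0) (j := 1) rfl (by decide)

theorem IsSymplecticForm.contDiff_flatForm {d : ℕ}
    {ω : PhaseSpace d → PhaseSpace d [⋀^Fin 2]→L[ℝ] ℝ} (hω : IsSymplecticForm ω) (r : ℕ) :
    ContDiff ℝ r fun x => flatForm d (ω x) := by
  have h0 : ContDiff ℝ r fun η : PhaseSpace d [⋀^Fin 2]→L[ℝ] ℝ => flatForm d η :=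
    ContinuousLinearMap.contDiff (𝕜 := ℝ) (E := PhaseSpace d [⋀^Fin 2]→L[ℝ] ℝ)
      (F := PhaseSpace d →L[ℝ] (PhaseSpace d →L[ℝ] ℝ)) (flatForm d)
  exact h0.comp (hω.smooth.of_le (by exact_mod_cast le_top))

theorem IsSymplecticForm.continuousAt_contractForm {d : ℕ}
    {ω : PhaseSpace d → PhaseSpace d [⋀^Fin 2]→L[ℝ] ℝ} (hω : IsSymplecticForm ω)
    {X : PhaseSpace d → PhaseSpace d} {x : PhaseSpace d} (hX : ContinuousAt X x) :
    ContinuousAt (fun y => contractForm (ω y) (X y)) x := by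
  have h : ContinuousAt (fun y => flatForm d (ω y)) x :=
    (hω.contDiff_flatForm 0).continuous.continuousAt
  exact ContinuousAt.clm_apply (E := PhaseSpace d) (F := PhaseSpace d →L[ℝ] ℝ) h hX

/-- A covector determines its Hamiltonian vector, by a linear map that depends smoothly on the
base point. -/
theorem IsSymplecticForm.exists_sharp {d : ℕ} {ω : PhaseSpace d → PhaseSpace d [⋀^Fin 2]→L[ℝ] ℝ}
    (hω : IsSymplecticForm ω) (r : ℕ) :
    ∃ L : PhaseSpace d → (PhaseSpace d →L[ℝ] ℝ) →L[ℝ] PhaseSpace d,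
      ContDiff ℝ r L ∧ ∀ x u, L x (contractForm (ω x) u) = u := by
  have he : ∀ x, ∃ e : PhaseSpace d ≃L[ℝ] (PhaseSpace d →L[ℝ] ℝ),
      (e : PhaseSpace d →L[ℝ] (PhaseSpace d →L[ℝ] ℝ)) = flatForm d (ω x) := by
    intro x
    have hinj : Function.Injective (flatForm d (ω x)).toLinearMap := by
      refine (injective_iff_map_eq_zero _).2 fun u hu => hω.nondegenerate x u fun v => ?_
      rw [← contractForm_apply, ← flatForm_apply]
      exact DFunLike.congr_fun hu v
    have hdim : Module.finrank ℝ (PhaseSpace d) = Module.finrank ℝ (PhaseSpace d →L[ℝ] ℝ) := by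
      rw [← (LinearMap.toContinuousLinearMap (𝕜 := ℝ) (E := PhaseSpace d) (F' := ℝ)).finrank_eq]
      exact (Subspace.dual_finrank_eq (K := ℝ) (V := PhaseSpace d)).symm
    refine ⟨(LinearMap.linearEquivOfInjective _ hinj hdim).toContinuousLinearEquiv, ?_⟩
    ext u v
    rfl
  choose e he using he
  refine ⟨fun x => (flatForm d (ω x)).inverse, ?_, fun x u => ?_⟩
  · rw [contDiff_iff_contDiffAt]
    intro x
    have h1 := (hω.contDiff_flatForm r).contDiffAt (x := x)
    refine ContDiffAt.comp x (g := ContinuousLinearMap.inverse) ?_ h1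
    rw [← he x]
    exact contDiffAt_map_inverse (e x)
  · dsimp only
    rw [← flatForm_apply, ← he x, ContinuousLinearMap.inverse_equiv]
    exact (e x).symm_apply_apply u

/-- The suspension of `F_ε` in normal form: the field is `Ya + ε^{2n} Yb` with an autonomous part
`Ya`, the bounds on both parts are uniform in `ε`, and the field is Hamiltonian with the autonomous
Hamiltonian `ha`, up to an error of order `ε^{2n}`. -/
theorem HasHamiltonianSuspensionOn.exists_field {d n : ℕ}
    {ω : PhaseSpace d → PhaseSpace d [⋀^Fin 2]→L[ℝ] ℝ} (hω : IsSymplecticForm ω)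
    {U V K : Set (PhaseSpace d)} {ε₁ : ℝ} {F : ℝ → PhaseSpace d → PhaseSpace d}
    (h : HasHamiltonianSuspensionOn ω U ε₁ n F) (hU : IsOpen U) (hV : IsOpen V) (hK : IsCompact K)
    (hVK : V ⊆ K) (hKU : K ⊆ U) (T : ℝ) :
    ∃ (C : ℝ) (ha : ℝ → PhaseSpace d → ℝ) (Ya : ℝ → PhaseSpace d → PhaseSpace d)
      (Yb : ℝ → ℝ × PhaseSpace d → PhaseSpace d), 0 ≤ C ∧ ∀ ε, 0 < |ε| → |ε| < ε₁ →
      ContDiffOn ℝ 1 (ha ε) U ∧ CkBoundedOn (2 * n) V C (Ya ε) ∧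
      CkBoundedOn (2 * n) (Ioo (-T) T ×ˢ V) C (Yb ε) ∧
      IsSuspensionOn U ε (F ε) (fun τ x => Ya ε x + ε ^ (2 * n) • Yb ε (τ, x)) ∧
      ∀ τ, ∀ x ∈ V, ‖contractForm (ω x) (Ya ε x + ε ^ (2 * n) • Yb ε (τ, x)) - fderiv ℝ (ha ε) x‖
        ≤ C * ε ^ (2 * n) := by
  obtain ⟨ha, hb, Y, M, h⟩ := h
  obtain ⟨L, hL, hLω⟩ := hω.exists_sharp (2 * n)
  let R : (ℝ × PhaseSpace d →L[ℝ] ℝ) →L[ℝ] (PhaseSpace d →L[ℝ] ℝ) :=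
    (ContinuousLinearMap.compL ℝ (PhaseSpace d) (ℝ × PhaseSpace d) ℝ).flip
      (ContinuousLinearMap.inr ℝ ℝ (PhaseSpace d))
  let Ba : ((PhaseSpace d →L[ℝ] ℝ) →L[ℝ] PhaseSpace d) →L[ℝ] (PhaseSpace d →L[ℝ] ℝ) →L[ℝ]
      PhaseSpace d := ContinuousLinearMap.id ℝ _
  let Bb : ((PhaseSpace d →L[ℝ] ℝ) →L[ℝ] PhaseSpace d) →L[ℝ] (ℝ × PhaseSpace d →L[ℝ] ℝ) →L[ℝ]
      PhaseSpace d := (ContinuousLinearMap.compL ℝ (ℝ × PhaseSpace d →L[ℝ] ℝ)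
        (PhaseSpace d →L[ℝ] ℝ) (PhaseSpace d)).flip R
  obtain ⟨Ca, hCa⟩ := hL.contDiffOn.exists_ckBoundedOn isOpen_univ hK (subset_univ _)
  obtain ⟨Cb, hCb⟩ := (hL.comp (contDiff_snd (E := ℝ))).contDiffOn.exists_ckBoundedOn isOpen_univ
    ((isCompact_Icc (a := -T) (b := T)).prod hK) (subset_univ _)
  obtain ⟨Da, hDa⟩ := CkBoundedOn.exists_bilinear (E := PhaseSpace d)
    (G := (PhaseSpace d →L[ℝ] ℝ) →L[ℝ] PhaseSpace d) (H := PhaseSpace d →L[ℝ] ℝ)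
    (J := PhaseSpace d) Ba (2 * n) Ca M
  obtain ⟨Db, hDb⟩ := CkBoundedOn.exists_bilinear (E := ℝ × PhaseSpace d)
    (G := (PhaseSpace d →L[ℝ] ℝ) →L[ℝ] PhaseSpace d) (H := ℝ × PhaseSpace d →L[ℝ] ℝ)
    (J := PhaseSpace d) Bb (2 * n) Cb M
  let C : ℝ := max (|M|) (max Da Db)
  refine ⟨C, ha, fun ε x => L x (fderiv ℝ (ha ε) x),
    fun ε p => L p.2 (R (fderiv ℝ (hb ε) p)), le_max_of_le_left (abs_nonneg M),
    fun ε hε0 hε => ?_⟩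
  obtain ⟨hha, hhb, -, hham, hsus⟩ := h ε hε0 hε
  have hprod : IsOpen ((univ : Set ℝ) ×ˢ U) := isOpen_univ.prod hU
  have hVU : V ⊆ U := hVK.trans hKU
  have hda := HasCkNormLE.fderiv hU hha
  have hdb := HasCkNormLE.fderiv hprod hhb
  have hfderiv : ∀ τ, ∀ x ∈ U, contractForm (ω x) (Y ε τ x)
      = fderiv ℝ (ha ε) x + ε ^ (2 * n) • R (fderiv ℝ (hb ε) (τ, x)) := by
    intro τ x hx
    have h1 : HasFDerivAt (ha ε) (fderiv ℝ (ha ε) x) x :=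
      ((hha.1.contDiffAt (hU.mem_nhds hx)).differentiableAt (by norm_cast)).hasFDerivAt
    have hmem : (τ, x) ∈ (univ : Set ℝ) ×ˢ U := ⟨mem_univ _, hx⟩
    have h2 : HasFDerivAt (hb ε) (fderiv ℝ (hb ε) (τ, x)) (τ, x) :=
      ((hhb.1.contDiffAt (hprod.mem_nhds hmem)).differentiableAt (by norm_cast)).hasFDerivAt
    have h3 : HasFDerivAt (fun y => (τ, y)) (ContinuousLinearMap.inr ℝ ℝ (PhaseSpace d)) x :=
      hasFDerivAt_prodMk_right τ x
    rw [hham τ x hx]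
    exact (h1.add ((h2.comp x h3).const_mul (ε ^ (2 * n)))).fderiv
  have hY : ∀ τ, ∀ x ∈ U, L x (fderiv ℝ (ha ε) x)
      + ε ^ (2 * n) • L x (R (fderiv ℝ (hb ε) (τ, x))) = Y ε τ x := by
    intro τ x hx
    rw [← map_smul, ← map_add, ← hfderiv τ x hx, hLω]
  refine ⟨hha.1.of_le (by norm_cast; omega), ?_, ?_, ⟨fun τ x hx => ?_, fun ξ hξ => ?_⟩,
    fun τ x hx => ?_⟩
  · exact (hDa V _ _ hV (hCa.mono hVK le_rfl) (hda.mono hVU le_rfl)).mono Subset.rfl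
      ((le_max_left _ _).trans (le_max_right _ _))
  · exact (hDb _ _ _ (isOpen_Ioo.prod hV) (hCb.mono (prod_mono Ioo_subset_Icc_self hVK) le_rfl)
      (hdb.mono (prod_mono (subset_univ _) hVU) le_rfl)).mono Subset.rfl
      ((le_max_right _ _).trans (le_max_right _ _))
  · dsimp only
    rw [hY _ x hx, hY _ x hx]
    exact hsus.1 τ x hx
  · refine hsus.2 ξ fun τ hτ => ⟨(hξ τ hτ).1, ?_⟩
    rw [← hY τ _ (hξ τ hτ).1]
    exact (hξ τ hτ).2
  · dsimp only
    have hx' := hVU hx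
    have hmem : (τ, x) ∈ (univ : Set ℝ) ×ˢ U := ⟨mem_univ _, hx'⟩
    rw [hY τ x hx', hfderiv τ x hx', add_sub_cancel_left, norm_smul, mul_comm, norm_pow,
      Real.norm_eq_abs, Even.pow_abs (even_two_mul n)]
    have hpow : 0 ≤ ε ^ (2 * n) := (even_two_mul n).pow_nonneg ε
    refine mul_le_mul_of_nonneg_right ?_ hpow
    calc ‖R (fderiv ℝ (hb ε) (τ, x))‖
        ≤ ‖fderiv ℝ (hb ε) (τ, x)‖ * ‖ContinuousLinearMap.inr ℝ ℝ (PhaseSpace d)‖ :=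
          ContinuousLinearMap.opNorm_comp_le _ _
      _ ≤ ‖fderiv ℝ (hb ε) (τ, x)‖ :=
          mul_le_of_le_one_right (norm_nonneg _) (ContinuousLinearMap.norm_inr_le_one _ _ _)
      _ ≤ M := hdb.norm_le hmem
      _ ≤ C := (le_abs_self M).trans (le_max_left _ _)

/-! ### The interpolating form and the Hamiltonian -/

/-- The estimates behind the theorem, uniform on a compact set: the interpolating form is the
differential of the autonomous Hamiltonian `ha` up to `ε^{2n}`, while one application of `F_ε`
changes `ha` by `ε^{2n+1}` only. -/
theorem HasHamiltonianSuspensionOn.exists_estimates {d n : ℕ} (hn : 1 ≤ n)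
    {ω : PhaseSpace d → PhaseSpace d [⋀^Fin 2]→L[ℝ] ℝ} (hω : IsSymplecticForm ω)
    {D U K : Set (PhaseSpace d)} {ε₁ : ℝ} (hε₁ : 0 < ε₁) {F : ℝ → PhaseSpace d → PhaseSpace d}
    (h : HasHamiltonianSuspensionOn ω U ε₁ n F) (hU : IsOpen U) (hUD : U ⊆ D) (hK : IsCompact K)
    (hKU : K ⊆ U) :
    ∃ (C ε₂ : ℝ) (ha : ℝ → PhaseSpace d → ℝ), 0 ≤ C ∧ 0 < ε₂ ∧ ∀ ε, 0 < |ε| → |ε| < ε₂ →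
      ContDiffOn ℝ 1 (ha ε) U ∧ ∀ x ∈ K,
        HasIterates D (F ε) n x ∧ ContinuousAt (interpolatingField D n ε (F ε)) x ∧
        ‖interpolatingForm ω D n ε (F ε) x - fderiv ℝ (ha ε) x‖ ≤ C * ε ^ (2 * n) ∧
        |ha ε (F ε x) - ha ε x| ≤ C * (ε ^ (2 * n) * |ε|) ∧ dist (F ε x) x ≤ C * |ε| := by
  obtain ⟨δ, hδ, hδU⟩ := hK.exists_cthickening_subset_open hU hKU
  set V := Metric.thickening δ K with hVdef
  have hV : IsOpen V := Metric.isOpen_thickening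
  have hVc : V ⊆ Metric.cthickening δ K := Metric.thickening_subset_cthickening δ K
  obtain ⟨a, ha0, haδ⟩ := exists_between hδ
  have hball : ∀ x ∈ K, Metric.closedBall x a ⊆ V := fun x hx =>
    (Metric.closedBall_subset_ball haδ).trans (Metric.ball_subset_thickening hx δ)
  -- The iterates are the positions at the times `|k| ≤ n`; they must lie in an open interval where
  -- the orbit is smooth, and the field is needed on its closure `[-(n + 1), n + 1]`.
  -- Time runs through `[-(n + 1), n + 1]`: the iterates need `|k| ≤ n`, and the last preimage is
  -- identified by one more period.
  obtain ⟨C₀, ha, Ya, Yb, hC₀, hfield⟩ := h.exists_field hω hU hV hK.cthickening hVc hδU (n + 2)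
  obtain ⟨A, hA1, hA⟩ := exists_norm_iteratedFDeriv_solution_le (PhaseSpace d) (2 * n) C₀
  obtain ⟨Cω, hCω⟩ := hK.exists_bound_of_continuousOn (f := fun x => flatForm d (ω x))
    (hω.contDiff_flatForm 0).continuous.continuousOn
  let C₁ : ℝ := (2 * d : ℕ) * ((2 * (n + 1)) ^ (2 * n) * A ^ (2 * n + 1))
  have hC₁ : 0 ≤ C₁ := by positivity
  let C : ℝ := |Cω| * C₁ + C₀ + C₀ * (2 * C₀) + 2 * C₀
  have hn0 : (0 : ℝ) ≤ n := n.cast_nonneg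
  -- The last bound on `ε` keeps orbits close to their initial point, see `hsmall`.
  -- The last bound on `ε` keeps orbits close to their initial point, see `hsmall`.
  refine ⟨C, min ε₁ (min 1 (a / (32 * (C₀ + 1) * (n + 1)))), ha, by positivity,
    by positivity, fun ε hε0 hε => ?_⟩
  rw [lt_min_iff, lt_min_iff] at hε
  obtain ⟨hha, hYa, hYb, hsus, herr⟩ := hfield ε hε0 hε.1
  have hε1 : |ε| ≤ 1 := hε.2.1.le
  have hpow : 0 ≤ ε ^ (2 * n) := (even_two_mul n).pow_nonneg ε
  have hpowabs : |ε| ^ (2 * n) = ε ^ (2 * n) := (even_two_mul n).pow_abs ε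
  have hpow1 : ε ^ (2 * n) ≤ 1 := hpowabs ▸ pow_le_one₀ (abs_nonneg ε) hε1
  set Y : ℝ → PhaseSpace d → PhaseSpace d := fun τ x => Ya ε x + ε ^ (2 * n) • Yb ε (τ, x) with hY
  have hJ : Icc (-(n + 1 : ℝ)) (n + 1) ⊆ Ioo (-(n + 2 : ℝ)) (n + 2) := fun τ hτ =>
    ⟨by linarith [hτ.1], by linarith [hτ.2]⟩
  have hYL : ∀ τ ∈ Icc (-(n + 1 : ℝ)) (n + 1), ∀ x ∈ V, ‖Y τ x‖ ≤ 2 * C₀ := by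
    intro τ hτ x hx
    calc ‖Y τ x‖ ≤ ‖Ya ε x‖ + ε ^ (2 * n) * ‖Yb ε (τ, x)‖ := by
          refine (norm_add_le _ _).trans_eq ?_
          rw [norm_smul, Real.norm_of_nonneg hpow]
      _ ≤ C₀ + 1 * C₀ := by
          gcongr
          · exact hYa.norm_le hx
          · exact hYb.norm_le ⟨hJ hτ, hx⟩
      _ = _ := by ring
  refine ⟨hha, fun x hx => ?_⟩
  have hsmall : |ε| * (2 * C₀) * (n + 1) ≤ a / 16 := by
    have := (lt_div_iff₀ (by positivity)).1 hε.2.2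
    have : 0 ≤ |ε| * (n + 1) := by positivity
    nlinarith
  have hYK : ∀ τ ∈ Icc (-(n + 1 : ℝ)) (n + 1),
      LipschitzOnWith ⟨2 * C₀, by positivity⟩ (Y τ) (Metric.closedBall x a) := by
    intro τ hτ
    refine LipschitzOnWith.of_dist_le_mul fun y hy z hz => ?_
    have h1 := hYa.norm_sub_le (by omega) hV (convex_closedBall x a) (hball x hx) hy hz
    have h2 := hYb.norm_sub_le (x := (τ, y)) (y := (τ, z)) (by omega) (isOpen_Ioo.prod hV)
      ((convex_singleton τ).prod (convex_closedBall x a))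
      (prod_mono (singleton_subset_iff.2 (hJ hτ)) (hball x hx)) ⟨rfl, hy⟩ ⟨rfl, hz⟩
    have h3 : ‖((τ, y) : ℝ × PhaseSpace d) - (τ, z)‖ = ‖y - z‖ := by
      simp [Prod.norm_def]
    rw [h3] at h2
    rw [dist_eq_norm, dist_eq_norm]
    change _ ≤ 2 * C₀ * ‖y - z‖
    calc ‖Y τ y - Y τ z‖
        = ‖(Ya ε y - Ya ε z) + ε ^ (2 * n) • (Yb ε (τ, y) - Yb ε (τ, z))‖ := by
          simp only [hY, smul_sub]
          congr 1
          abel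
      _ ≤ ‖Ya ε y - Ya ε z‖ + ε ^ (2 * n) * ‖Yb ε (τ, y) - Yb ε (τ, z)‖ := by
          refine (norm_add_le _ _).trans_eq ?_
          rw [norm_smul, Real.norm_of_nonneg hpow]
      _ ≤ C₀ * ‖y - z‖ + 1 * (C₀ * ‖y - z‖) := by gcongr
      _ = _ := by ring
  have hYc : ∀ y ∈ Metric.closedBall x a,
      ContinuousOn (fun τ => Y τ y) (Icc (-(n + 1 : ℝ)) (n + 1)) := by
    intro y hy
    have h1 : ContinuousOn (fun τ => Yb ε (τ, y)) (Icc (-(n + 1 : ℝ)) (n + 1)) :=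
      hYb.1.continuousOn.comp (by fun_prop) fun τ hτ => ⟨hJ hτ, hball x hx hy⟩
    exact continuousOn_const.add (h1.const_smul (ε ^ (2 * n)))
  obtain ⟨ξ, hξ0, hξ, hiter, hit⟩ := hsus.exists_orbit (n := n) (L := ⟨2 * C₀, by positivity⟩) hUD
    ha0 ((hball x hx).trans (hVc.trans hδU)) (fun τ hτ y hy => hYL τ hτ y (hball x hx hy)) hYK hYc
    hsmall
  have hξV : ∀ τ ∈ Icc (-(n + 1 : ℝ)) (n + 1), ξ τ ∈ V := fun τ hτ => hball x hx (hξ τ hτ).1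
  have hS : Ioo (-(n + 1 : ℝ)) (n + 1) ⊆ Icc (-(n + 1 : ℝ)) (n + 1) := Ioo_subset_Icc_self
  have hξd : ∀ τ ∈ Ioo (-(n + 1 : ℝ)) (n + 1), HasDerivAt ξ (ε • Y τ (ξ τ)) τ := fun τ hτ =>
    (hξ τ (hS hτ)).2.hasDerivAt (Icc_mem_nhds hτ.1 hτ.2)
  have h0S : (0 : ℝ) ∈ Ioo (-(n + 1 : ℝ)) (n + 1) := ⟨by linarith, by linarith⟩
  obtain ⟨hξc, hξb⟩ := hA ε (Ioo (-(n + 1 : ℝ)) (n + 1)) V (Ya ε) (Yb ε) ξ hε1 isOpen_Ioo hV hYa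
    (hYb.mono (prod_mono (hS.trans hJ) Subset.rfl) le_rfl) (fun τ hτ => hξV τ (hS hτ)) hξd
  have hint := norm_deriv_sub_interpolatingField_le (D := D) (f := F ε) (x := x) (abs_pos.1 hε0)
    hξc (hξb (2 * n + 1) (by omega) le_rfl) fun k h1 h2 => (hit k h1 h2).1
  have hxV : x ∈ V := hball x hx (Metric.mem_closedBall_self ha0.le)
  set X := interpolatingField D n ε (F ε) x with hX
  have hXY : ‖X - Y 0 x‖ ≤ C₁ * ε ^ (2 * n) := by
    rw [(hξd 0 h0S).deriv, hξ0, ← smul_sub, norm_smul, Real.norm_eq_abs, norm_sub_rev] at hint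
    refine le_of_mul_le_mul_left (hint.trans_eq ?_) hε0
    rw [mul_pow A, pow_succ |ε|, hpowabs]
    simp only [C₁]
    ring
  have h01 : Icc (0 : ℝ) 1 ⊆ Icc (-(n + 1 : ℝ)) (n + 1) :=
    Icc_subset_Icc (by linarith) (by linarith)
  have hF1 : F ε x = ξ 1 := by
    have := (hit 1 (by omega) (by omega)).1
    simpa [iterateZ] using this
  refine ⟨hiter, continuousAt_interpolatingField fun k h1 h2 => (hit k h1 h2).2, ?_, ?_, ?_⟩
  · have hlin : interpolatingForm ω D n ε (F ε) x - fderiv ℝ (ha ε) x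
        = flatForm d (ω x) (X - Y 0 x) + (contractForm (ω x) (Y 0 x) - fderiv ℝ (ha ε) x) := by
      rw [map_sub, flatForm_apply, flatForm_apply, interpolatingForm]
      abel
    rw [hlin]
    calc _ ≤ |Cω| * (C₁ * ε ^ (2 * n)) + C₀ * ε ^ (2 * n) := by
          refine (norm_add_le _ _).trans (add_le_add ?_ (herr 0 x hxV))
          refine ((flatForm d (ω x)).le_opNorm _).trans ?_
          gcongr
          exact (hCω x hx).trans (le_abs_self _)
      _ = (|Cω| * C₁ + C₀) * ε ^ (2 * n) := by ring
      _ ≤ C * ε ^ (2 * n) := by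
          gcongr
          have : 0 ≤ C₀ * (2 * C₀) + 2 * C₀ := by positivity
          simp only [C]
          linarith
  · -- `ha` is constant along its own Hamiltonian field, of which `Y` is a perturbation.
    have hd : ∀ τ ∈ Icc (0 : ℝ) 1, HasDerivWithinAt (fun τ => ha ε (ξ τ))
        (fderiv ℝ (ha ε) (ξ τ) (ε • Y τ (ξ τ))) (Icc 0 1) τ := by
      intro τ hτ
      have hmem : ξ τ ∈ U := hδU (hVc (hξV τ (h01 hτ)))
      have h1 : HasFDerivAt (ha ε) (fderiv ℝ (ha ε) (ξ τ)) (ξ τ) :=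
        ((hha.contDiffAt (hU.mem_nhds hmem)).differentiableAt one_ne_zero).hasFDerivAt
      exact h1.comp_hasDerivWithinAt τ ((hξ τ (h01 hτ)).2.mono h01)
    have hb : ∀ τ ∈ Icc (0 : ℝ) 1, ‖fderiv ℝ (ha ε) (ξ τ) (ε • Y τ (ξ τ))‖
        ≤ C₀ * (2 * C₀) * (ε ^ (2 * n) * |ε|) := by
      intro τ hτ
      have hτV := hξV τ (h01 hτ)
      have hself : fderiv ℝ (ha ε) (ξ τ) (Y τ (ξ τ)) = -(contractForm (ω (ξ τ)) (Y τ (ξ τ))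
          - fderiv ℝ (ha ε) (ξ τ)) (Y τ (ξ τ)) := by
        rw [sub_apply, contractForm_self]
        ring
      rw [map_smul, norm_smul, Real.norm_eq_abs, hself, norm_neg]
      calc _ ≤ |ε| * (C₀ * ε ^ (2 * n) * (2 * C₀)) := by
            gcongr
            refine (ContinuousLinearMap.le_opNorm _ _).trans ?_
            gcongr
            · exact herr τ _ hτV
            · exact hYL τ (h01 hτ) _ hτV
        _ = _ := by ring
    have hmv := (convex_Icc (0 : ℝ) 1).norm_image_sub_le_of_norm_hasDerivWithin_le hd hb
      (left_mem_Icc.2 zero_le_one) (right_mem_Icc.2 zero_le_one)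
    rw [hF1, ← hξ0]
    simp only [sub_zero, norm_one, mul_one, Real.norm_eq_abs] at hmv
    refine hmv.trans ?_
    gcongr
    have : 0 ≤ |Cω| * C₁ + C₀ + 2 * C₀ := by positivity
    simp only [C]
    linarith
  · have hmv := (convex_Icc (0 : ℝ) 1).norm_image_sub_le_of_norm_hasDerivWithin_le
      (C := |ε| * (2 * C₀)) (fun τ hτ => (hξ τ (h01 hτ)).2.mono h01) (fun τ hτ => ?_)
      (left_mem_Icc.2 zero_le_one) (right_mem_Icc.2 zero_le_one)
    · rw [hF1, dist_eq_norm]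
      simp only [hξ0, sub_zero, norm_one, mul_one] at hmv
      refine hmv.trans ?_
      rw [mul_comm]
      gcongr
      have : 0 ≤ |Cω| * C₁ + C₀ + C₀ * (2 * C₀) := by positivity
      simp only [C]
      linarith
    · rw [norm_smul, Real.norm_eq_abs]
      gcongr
      exact hYL τ (h01 hτ) _ (hξV τ (h01 hτ))

theorem mainTheorem4 (d n : ℕ) (hd : 1 ≤ d) (hn : 1 ≤ n)
    (ω : PhaseSpace d → PhaseSpace d [⋀^Fin 2]→L[ℝ] ℝ) (hω : IsSymplecticForm ω)
    (D : Set (PhaseSpace d)) (hD : IsOpen D)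
    (ε₀ : ℝ) (hε₀ : 0 < ε₀) (F : ℝ → PhaseSpace d → PhaseSpace d)
    (hF : IsNearIdentitySymplecticFamily ω D ε₀ (2 * n + 1 : ℕ) F)
    (xb : PhaseSpace d) (hxb : xb ∈ D)
    (γ : ∀ x : PhaseSpace d, Path xb x) (Cγ : ℝ) (hγ : IsPathRule D xb γ Cγ)
    (hsusp : HasHamiltonianSuspension ω D n F)
    (D₀ : Set (PhaseSpace d)) (hD₀ : D₀ ⊆ D) (hD₀c : IsCompact D₀) :
    ∃ C : ℝ, ∃ ε₁ : ℝ, 0 < ε₁ ∧ ε₁ ≤ ε₀ ∧ ∀ ε : ℝ, 0 < |ε| → |ε| < ε₁ →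
      (∀ x ∈ D₀,
        AdiabaticInvariantDefined ω D γ F n x ε ∧
        AdiabaticInvariantDefined ω D γ F n (F ε x) ε ∧
        |adiabaticInvariant ω D γ F n (F ε x) ε - adiabaticInvariant ω D γ F n x ε|
          ≤ C * ε ^ (2 * n)) ∧
      (∀ (T : ℝ) (N : ℕ), (N : ℝ) ≤ T * (ε ^ (2 * n))⁻¹ →
        ∀ x ∈ D₀, (∀ k ≤ N, (F ε)^[k] x ∈ D₀) →
        |adiabaticInvariant ω D γ F n ((F ε)^[N] x) ε - adiabaticInvariant ω D γ F n x ε|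
          ≤ C * (1 + T) * |ε|) := by
  -- `D₁` is a neighbourhood of `D₀` that contains its image; the paths that lead there
  -- stay in `K`.
  obtain ⟨δ, hδ, hδD⟩ := hD₀c.exists_cthickening_subset_open hD hD₀
  set D₁ := Metric.cthickening δ D₀ with hD₁
  have hD₁c : IsCompact D₁ := hD₀c.cthickening
  have hD₀₁ : D₀ ⊆ D₁ := Metric.self_subset_cthickening D₀
  obtain ⟨K, hKD, hK, hγK⟩ := hγ.compact D₁ hδD hD₁c
  obtain ⟨U, hU, hKU, hUD, ε₁, hε₁, hs⟩ := hsusp K hKD hK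
  obtain ⟨C, ε₂, ha, hC, hε₂, hest⟩ := hs.exists_estimates hn hω hε₁ hU hUD hK hKU
  have hD₁K : D₁ ⊆ K := fun x hx => by simpa using hγK x hx 1
  obtain ⟨R, hR⟩ := hD₁c.isBounded.subset_closedBall xb
  -- `E ε^{2n}` bounds the difference of `h_n` and `ha - ha xb` on `D₁`.
  let E : ℝ := C * (|Cγ| * |R|)
  have hE : 0 ≤ E := by positivity
  refine ⟨2 * E + C, min ε₀ (min ε₂ (min 1 (δ / (C + 1)))), by positivity, min_le_left _ _,
    fun ε hε0 hε => ?_⟩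
  rw [lt_min_iff, lt_min_iff, lt_min_iff] at hε
  obtain ⟨-, hεε₂, hε1, hεδ⟩ := hε
  obtain ⟨hha, hest⟩ := hest ε hε0 hεε₂
  have hpow : 0 < ε ^ (2 * n) := (even_two_mul n).pow_pos (abs_pos.1 hε0)
  have hpow1 : ε ^ (2 * n) ≤ |ε| := by
    rw [← (even_two_mul n).pow_abs]
    exact pow_le_of_le_one (abs_nonneg ε) hε1.le (by omega)
  have hFD₁ : ∀ x ∈ D₀, F ε x ∈ D₁ := by
    intro x hx
    refine Metric.mem_cthickening_of_dist_le _ x _ _ hx ?_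
    refine (hest x (hD₁K (hD₀₁ hx))).2.2.2.2.trans ?_
    have := (lt_div_iff₀ (by positivity)).1 hεδ
    nlinarith [abs_nonneg ε]
  have hν : ∀ x ∈ D₁, ContinuousOn (interpolatingForm ω D n ε (F ε)) (range (γ x)) := by
    rintro x hx _ ⟨s, rfl⟩
    exact (hω.continuousAt_contractForm (hest _ (hγK x hx s)).2.1).continuousWithinAt
  have hdef : ∀ x ∈ D₁, AdiabaticInvariantDefined ω D γ F n x ε := fun x hx =>
    ⟨hδD hx, fun s => (hest _ (hγK x hx s)).1,
      (hγ.piecewise x (hδD hx)).curveIntegrable (hν x hx)⟩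
  have happrox : ∀ x ∈ D₁, |adiabaticInvariant ω D γ F n x ε - (ha ε x - ha ε xb)|
      ≤ E * ε ^ (2 * n) := by
    intro x hx
    have hpw := hγ.piecewise x (hδD hx)
    have hγU : ∀ s, γ x s ∈ U := fun s => hKU (hγK x hx s)
    have hle := hpw.abs_curveIntegral_sub_le (hν x hx) hU hha hγU (c := C * ε ^ (2 * n))
      fun s => (hest _ (hγK x hx s)).2.2.1
    refine hle.trans ?_
    have hlen : pathLength (γ x) ≤ |Cγ| * |R| := by
      refine (hγ.length_le x (hδD hx)).trans ?_
      have h1 : ‖x - xb‖ ≤ |R| := by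
        rw [← dist_eq_norm]
        exact (Metric.mem_closedBall.1 (hR hx)).trans (le_abs_self R)
      gcongr
      exact le_abs_self Cγ
    calc _ ≤ C * ε ^ (2 * n) * (|Cγ| * |R|) := by gcongr
      _ = E * ε ^ (2 * n) := by
          simp only [E]
          ring
  have hdiff : ∀ x ∈ D₁, ∀ y ∈ D₁,
      |adiabaticInvariant ω D γ F n y ε - adiabaticInvariant ω D γ F n x ε|
        ≤ 2 * E * ε ^ (2 * n) + |ha ε y - ha ε x| := by
    intro x hx y hy
    have h1 := abs_le.1 (happrox x hx)
    have h2 := abs_le.1 (happrox y hy)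
    have h3 := le_abs_self (ha ε y - ha ε x)
    have h4 := neg_abs_le (ha ε y - ha ε x)
    exact abs_le.2 ⟨by linarith, by linarith⟩
  have hdrift : ∀ x ∈ D₀, |ha ε (F ε x) - ha ε x| ≤ C * (ε ^ (2 * n) * |ε|) := fun x hx =>
    (hest x (hD₁K (hD₀₁ hx))).2.2.2.1
  refine ⟨fun x hx => ⟨hdef x (hD₀₁ hx), hdef _ (hFD₁ x hx), ?_⟩, fun T N hN x hx hiter => ?_⟩
  · refine (hdiff x (hD₀₁ hx) _ (hFD₁ x hx)).trans ?_
    have h1 : C * (ε ^ (2 * n) * |ε|) ≤ C * (ε ^ (2 * n) * 1) := by gcongr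
    linarith [hdrift x hx]
  · have hsum : ∀ m ≤ N, |ha ε ((F ε)^[m] x) - ha ε x| ≤ m * (C * (ε ^ (2 * n) * |ε|)) := by
      intro m
      induction m with
      | zero => simp
      | succ m ih =>
        intro hm
        rw [Function.iterate_succ_apply']
        have h1 := hdrift _ (hiter m (by omega))
        have h2 := abs_sub_le (ha ε (F ε ((F ε)^[m] x))) (ha ε ((F ε)^[m] x)) (ha ε x)
        have h3 := ih (by omega)
        push_cast
        linarith
    have hNT : (N : ℝ) * ε ^ (2 * n) ≤ T := by
      rwa [← div_eq_mul_inv, le_div_iff₀ hpow] at hN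
    have hT : 0 ≤ T := le_trans (by positivity) hNT
    calc _ ≤ 2 * E * ε ^ (2 * n) + N * (C * (ε ^ (2 * n) * |ε|)) :=
          (hdiff x (hD₀₁ hx) _ (hD₀₁ (hiter N le_rfl))).trans
            (add_le_add le_rfl (hsum N le_rfl))
      _ = 2 * E * ε ^ (2 * n) + C * (N * ε ^ (2 * n)) * |ε| := by ring
      _ ≤ 2 * E * |ε| + C * T * |ε| := by gcongr
      _ ≤ (2 * E + C) * (1 + T) * |ε| := by
          have : 0 ≤ 2 * E * T + C := by positivity
          nlinarith [mul_nonneg this hε0.le]
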